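/- Let $\mathbb{K}$ be a field of characteristic $0$; all gradings are $\mathbb{Z}$-gradings. A curved DG-algebra $(A,d,R)$ over $\mathbb{K}$ is a unital graded associative $\mathbb{K}$-algebra $A$ with a derivation $d\colon A^*\to A^{*+1}$ of degree one and an element $R\in A^2$ such that $d(R)=0$ and $d^2(x)=[R,x]$ for every $x\in A$, where $[a,b]=ab-(-1)^{|a||b|}ba$ is the graded commutator; $[A,A]$ is the linear span of all graded commutators. A curved Lie ideal of $(A,d,R)$ is a homogeneous Lie ideal $I\subset A$ (for the graded commutator) with $d(I)\subset I$ and $R\in I$; then $A/I$ is a DG-Lie algebra. For $k\ge 1$, $I^{(k)}A$ is the linear span of all products $e_1\cdots e_k a$ with $e_1,\dots,e_k\in I$, $a\in A$. A trace map on $(A,d,R)$ is a complex of vector spaces $(C,\delta)$ with a morphism of graded vector spaces $\operatorname{Tr}\colon A\to C$ such that $\operatorname{Tr}\circ d=\delta\circ\operatorname{Tr}$ and $\operatorname{Tr}([A,A])=0$; then $\operatorname{Tr}(I^{(k+1)}A)$ is a subcomplex of $C$ for every $k\ge 0$. The shift $C[m]$ is given by $C[m]^n=C^{n+m}$ with differential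 $(-1)^m\delta$, and a complex is regarded as a DG-Lie algebra with trivial bracket. For DG-Lie algebras $L,M$, an $L_\infty$ morphism $f\colon L\rightsquigarrow M$ is a morphism of DG-coalgebras $S(L[1])\to S(M[1])$ between the bar constructions. Equivalently, it is a sequence of degree zero linear maps $f_n\colon L[1]^{\odot n}\to M[1]$, $n\ge 1$ (its Taylor coefficients), such that for all $n\ge1$ and all homogeneous $x_1,\dots,x_n\in L$ \[ q_1f_n(x_1,\dots,x_n)+\tfrac12\sum_{p+q=n,\ p,q\ge1}\ \sum_{\sigma\in S(p,q)}\varepsilon(\sigma)\,q_2\big(f_p(x_{\sigma(1)},\dots,x_{\sigma(p)}),f_q(x_{\sigma(p+1)},\dots,x_{\sigma(n)})\big)\] \[ =\sum_{i=1}^n(-1)^{\sum_{j<i}(|x_j|-1)}f_n(x_1,\dots,q_1x_i,\dots,x_n)+\sum_{\sigma\in S(2,n-2)}\varepsilon(\sigma)\,f_{n-1}\big(q_2(x_{\sigma(1)},x_{\sigma(2)}),x_{\sigma(3)},\dots,x_{\sigma(n)}\big),\] where $q_1(x)=-d(x)$ and $q_2(x,y)=(-1)^{|x|}[x,y]$ in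 either DG-Lie algebra, with $|x|$ the degree before the shift, $S(p,q)$ is the set of $(p,q)$-unshuffles (empty sum if $q<0$), and $\varepsilon(\sigma)$ is the Koszul sign defined by $x_{\sigma(1)}\odot\cdots\odot x_{\sigma(n)}=\varepsilon(\sigma)\,x_1\odot\cdots\odot x_n$ in $L[1]^{\odot n}$. The linear component of $f$ is $f_1$, viewed as a map $L\to M$. **Corollary 2.9.** Let $I$ be a curved Lie ideal of a curved DG-algebra $(A,d,R)$ over $\mathbb{K}$ and let $\operatorname{Tr}\colon A\to C$ be a trace map. Then for every $k\ge 0$ there exists an $L_\infty$ morphism \[ \eta^k\colon \frac{A}{I}\rightsquigarrow \frac{C}{\operatorname{Tr}(I^{(k+1)}A)}[2k]\] (the target has trivial bracket) with linear component \[ \eta^k_1\colon \frac{A}{I}\to \frac{C}{\operatorname{Tr}(I^{(k+1)}A)}[2k],\qquad \eta^k_1(x)=\frac{1}{k!}\operatorname{Tr}(R^k x).\] -/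

import Mathlib

/-! Gradings are `ℤ`-gradings by subspaces: `V = ⨁ n, gr n` (Mathlib's `DirectSum.Decomposition`).
Signs `(-1)^n`, `n : ℤ`, are written `n.negOnePow : ℤˣ`. -/

/-! ### Generalities on graded vector spaces -/

section Graded

variable {K V : Type*} [Field K] [AddCommGroup V] [Module K V]

theorem isHomogeneous_iff_le_iSup (gr : ℤ → Submodule K V) [DirectSum.Decomposition gr]
    (N : Submodule K V) : DirectSum.SetLike.IsHomogeneous gr N ↔ N ≤ ⨆ n, N ⊓ gr n := by
  classical
  constructor
  · intro h x hx
    rw [← DirectSum.sum_support_decompose gr x]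
    exact Submodule.sum_mem _ fun i _ =>
      Submodule.mem_iSup_of_mem i ⟨h i hx, SetLike.coe_mem _⟩
  · intro h i x hx
    have hx' := h hx
    induction hx' using Submodule.iSup_induction' with
    | mem j y hy =>
      by_cases hij : j = i
      · subst hij
        rw [DirectSum.decompose_of_mem_same gr hy.2]
        exact hy.1
      · rw [DirectSum.decompose_of_mem_ne gr hy.2 hij]
        exact N.zero_mem
    | zero => simp
    | add y z hy hz h1 h2 =>
      have key : ∀ w ∈ ⨆ n, N ⊓ gr n, w ∈ N := fun w hw =>
        (iSup_le (fun n => inf_le_left) : (⨆ n, N ⊓ gr n) ≤ N) hw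
      rw [DirectSum.decompose_add]
      exact N.add_mem (h1 (key _ hy)) (h2 (key _ hz))

theorem isInternal_quotient (gr : ℤ → Submodule K V) [DirectSum.Decomposition gr]
    (N : Submodule K V) (hN : DirectSum.SetLike.IsHomogeneous gr N) :
    DirectSum.IsInternal (fun n => (gr n).map N.mkQ) := by
  rw [DirectSum.isInternal_submodule_iff_iSupIndep_and_iSup_eq_top]
  refine ⟨fun i => ?_, ?_⟩
  · let p : V →ₗ[K] V :=
      { toFun := fun v => (DirectSum.decompose gr v i : V)
        map_add' := fun v w => by simp
        map_smul' := fun c v => by rw [DirectSum.decompose_smul]; rfl }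
    let q : (V ⧸ N) →ₗ[K] (V ⧸ N) := N.mapQ N p fun v hv => hN i hv
    have hq : ∀ v, q (N.mkQ v) = N.mkQ (DirectSum.decompose gr v i : V) := fun _ => rfl
    rw [Submodule.disjoint_def]
    rintro _ ⟨v, hv, rfl⟩ h2
    have h3 : (⨆ j, ⨆ (_ : j ≠ i), (gr j).map N.mkQ) ≤ LinearMap.ker q := by
      refine iSup_le fun j => iSup_le fun hj => ?_
      rintro _ ⟨w, hw, rfl⟩
      rw [LinearMap.mem_ker, hq, DirectSum.decompose_of_mem_ne gr hw hj, map_zero]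
    have h4 := LinearMap.mem_ker.1 (h3 h2)
    rwa [hq, DirectSum.decompose_of_mem_same gr hv] at h4
  · rw [← Submodule.map_iSup, (DirectSum.Decomposition.isInternal gr).submodule_iSup_eq_top,
      Submodule.map_top, Submodule.range_mkQ]

theorem isInternal_shift {gr : ℤ → Submodule K V} (h : DirectSum.IsInternal gr) (m : ℤ) :
    DirectSum.IsInternal (fun n => gr (n + m)) := by
  rw [DirectSum.isInternal_submodule_iff_iSupIndep_and_iSup_eq_top] at h ⊢
  refine ⟨h.1.comp (add_left_injective m), ?_⟩
  rw [← h.2]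
  exact (Equiv.addRight m).surjective.iSup_comp gr

end Graded

/-! ### Complexes of vector spaces and DG-Lie algebras -/

/-- A (cochain) complex of vector spaces, as a graded vector space `V` with a square-zero
differential of degree one. -/
structure DGSpace (K V : Type*) [Field K] [AddCommGroup V] [Module K V] where
  gr : ℤ → Submodule K V
  decomposition : DirectSum.Decomposition gr
  d : V →ₗ[K] V
  d_mem : ∀ {n : ℤ} {x : V}, x ∈ gr n → d x ∈ gr (n + 1)
  d_d : ∀ x, d (d x) = 0

attribute [instance] DGSpace.decomposition

/-- A differential graded Lie algebra. -/
structure DGLieAlgebra (K V : Type*) [Field K] [AddCommGroup V] [Module K V]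
    extends DGSpace K V where
  bracket : V →ₗ[K] V →ₗ[K] V
  bracket_mem : ∀ {i j : ℤ} {x y : V}, x ∈ gr i → y ∈ gr j → bracket x y ∈ gr (i + j)
  antisymm : ∀ {i j : ℤ} {x y : V}, x ∈ gr i → y ∈ gr j →
    bracket x y = -((i * j).negOnePow • bracket y x)
  jacobi : ∀ {i j l : ℤ} {x y z : V}, x ∈ gr i → y ∈ gr j → z ∈ gr l →
    bracket x (bracket y z) = bracket (bracket x y) z + (i * j).negOnePow • bracket y (bracket x z)
  leibniz : ∀ {i j : ℤ} {x y : V}, x ∈ gr i → y ∈ gr j →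
    d (bracket x y) = bracket (d x) y + i.negOnePow • bracket x (d y)

namespace DGSpace

variable {K V : Type*} [Field K] [AddCommGroup V] [Module K V]

/-- The quotient of a complex by a subcomplex, on the space `V ⧸ N`. -/
noncomputable def quotient (C : DGSpace K V) (N : Submodule K V)
    (hN : DirectSum.SetLike.IsHomogeneous C.gr N) (hd : ∀ x ∈ N, C.d x ∈ N) : DGSpace K (V ⧸ N) where
  gr n := (C.gr n).map N.mkQ
  decomposition := (isInternal_quotient C.gr N hN).chooseDecomposition
  d := N.mapQ N C.d hd
  d_mem := by
    rintro n _ ⟨x, hx, rfl⟩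
    exact ⟨C.d x, C.d_mem hx, rfl⟩
  d_d x := by
    obtain ⟨x, rfl⟩ := N.mkQ_surjective x
    simp [C.d_d]

/-- The shift `C[m]`: `C[m]^n = C^{n+m}`, with differential `(-1)^m d`. -/
noncomputable def shift (C : DGSpace K V) (m : ℤ) : DGSpace K V where
  gr n := C.gr (n + m)
  decomposition :=
    (isInternal_shift (DirectSum.Decomposition.isInternal C.gr) m).chooseDecomposition
  d := m.negOnePow • C.d
  d_mem := by
    intro n x hx
    have h := C.d_mem hx
    rw [add_right_comm] at h
    rcases Int.units_eq_one_or m.negOnePow with e | e <;> simpa [e] using h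
  d_d x := by
    rcases Int.units_eq_one_or m.negOnePow with e | e <;> simp [e, C.d_d]

/-- A complex, viewed as a DG-Lie algebra with trivial bracket. -/
def abelian (C : DGSpace K V) : DGLieAlgebra K V where
  toDGSpace := C
  bracket := 0
  bracket_mem := by simp
  antisymm := by simp
  jacobi := by simp
  leibniz := by simp

end DGSpace

/-! ### Curved DG-algebras -/

/-- A curved DG-algebra `(A, d, R)` over `K`: a unital graded associative algebra, a derivation
`d` of degree one, and `R` of degree two with `d R = 0` and `d² = [R, -]`. -/
structure CurvedDGAlgebra (K A : Type*) [Field K] [Ring A] [Algebra K A] where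
  gr : ℤ → Submodule K A
  gradedAlgebra : GradedAlgebra gr
  d : A →ₗ[K] A
  d_mem : ∀ {n : ℤ} {x : A}, x ∈ gr n → d x ∈ gr (n + 1)
  d_mul : ∀ {n : ℤ} {x : A}, x ∈ gr n → ∀ y, d (x * y) = d x * y + n.negOnePow • (x * d y)
  R : A
  R_mem : R ∈ gr 2
  d_R : d R = 0
  d_d : ∀ x, d (d x) = R * x - x * R

attribute [instance] CurvedDGAlgebra.gradedAlgebra

namespace CurvedDGAlgebra

variable {K A : Type*} [Field K] [Ring A] [Algebra K A] (𝒜 : CurvedDGAlgebra K A)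

/-- The linear map that multiplies the component of degree `j` by `(-1)^{ij}`, for every `j`. -/
noncomputable def signTwist (i : ℤ) : A →ₗ[K] A :=
  DirectSum.toModule K ℤ A (fun j => (i * j).negOnePow • (𝒜.gr j).subtype) ∘ₗ
    (DirectSum.decomposeLinearEquiv 𝒜.gr).toLinearMap

/-- The graded commutator, the bilinear map with `[a, b] = ab - (-1)^{|a||b|} ba` for homogeneous
`a`, `b` (see `comm_apply`). -/
noncomputable def comm : A →ₗ[K] A →ₗ[K] A :=
  LinearMap.mul K A -
    DirectSum.toModule K ℤ (A →ₗ[K] A)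
      (fun i => (LinearMap.mul K A).flip.compl₂ (𝒜.signTwist i) ∘ₗ (𝒜.gr i).subtype) ∘ₗ
    (DirectSum.decomposeLinearEquiv 𝒜.gr).toLinearMap

variable {𝒜}

theorem signTwist_apply (i : ℤ) {j : ℤ} {y : A} (hy : y ∈ 𝒜.gr j) :
    𝒜.signTwist i y = (i * j).negOnePow • y := by
  lift y to 𝒜.gr j using hy
  simp only [signTwist, LinearMap.comp_apply, LinearEquiv.coe_coe,
    DirectSum.decomposeLinearEquiv_apply_coe, DirectSum.toModule_lof]
  rfl

theorem comm_apply {i j : ℤ} {x y : A} (hx : x ∈ 𝒜.gr i) (hy : y ∈ 𝒜.gr j) :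
    𝒜.comm x y = x * y - (i * j).negOnePow • (y * x) := by
  have h := signTwist_apply i hy
  lift x to 𝒜.gr i using hx
  simp only [comm, LinearMap.sub_apply, LinearMap.comp_apply, LinearEquiv.coe_coe,
    DirectSum.decomposeLinearEquiv_apply_coe, DirectSum.toModule_lof, LinearMap.mul_apply',
    LinearMap.compl₂_apply, LinearMap.flip_apply, Submodule.subtype_apply, h, smul_mul_assoc]

theorem comm_mem {i j : ℤ} {x y : A} (hx : x ∈ 𝒜.gr i) (hy : y ∈ 𝒜.gr j) :
    𝒜.comm x y ∈ 𝒜.gr (i + j) := by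
  rw [comm_apply hx hy]
  have h1 := SetLike.mul_mem_graded hx hy
  have h2 := SetLike.mul_mem_graded hy hx
  rw [add_comm j i] at h2
  rcases Int.units_eq_one_or (i * j).negOnePow with e | e <;> rw [e]
  · simpa using Submodule.sub_mem _ h1 h2
  · simpa using Submodule.add_mem _ h1 h2

theorem comm_antisymm {i j : ℤ} {x y : A} (hx : x ∈ 𝒜.gr i) (hy : y ∈ 𝒜.gr j) :
    𝒜.comm x y = -((i * j).negOnePow • 𝒜.comm y x) := by
  rw [comm_apply hx hy, comm_apply hy hx, mul_comm j i]
  rcases Int.units_eq_one_or (i * j).negOnePow with e | e <;> simp [e]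

theorem comm_jacobi {i j l : ℤ} {x y z : A} (hx : x ∈ 𝒜.gr i) (hy : y ∈ 𝒜.gr j)
    (hz : z ∈ 𝒜.gr l) :
    𝒜.comm x (𝒜.comm y z) =
      𝒜.comm (𝒜.comm x y) z + (i * j).negOnePow • 𝒜.comm y (𝒜.comm x z) := by
  rw [comm_apply hx (comm_mem hy hz), comm_apply (comm_mem hx hy) hz,
    comm_apply hy (comm_mem hx hz), comm_apply hx hy, comm_apply hy hz, comm_apply hx hz,
    mul_add, mul_add, add_mul, mul_comm j i, Int.negOnePow_add, Int.negOnePow_add,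
    Int.negOnePow_add]
  rcases Int.units_eq_one_or (i * j).negOnePow with e | e <;>
  rcases Int.units_eq_one_or (i * l).negOnePow with e' | e' <;>
  rcases Int.units_eq_one_or (j * l).negOnePow with e'' | e'' <;>
  simp only [e, e', e'', one_smul, mul_one, Units.neg_smul, neg_neg, mul_neg] <;>
  noncomm_ring

theorem d_comm {i j : ℤ} {x y : A} (hx : x ∈ 𝒜.gr i) (hy : y ∈ 𝒜.gr j) :
    𝒜.d (𝒜.comm x y) = 𝒜.comm (𝒜.d x) y + i.negOnePow • 𝒜.comm x (𝒜.d y) := by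
  have e0 : ∀ (u : ℤˣ) (a : A), 𝒜.d (u • a) = u • 𝒜.d a := by
    intro u a
    rcases Int.units_eq_one_or u with e | e <;> simp [e]
  rw [comm_apply hx hy, comm_apply (𝒜.d_mem hx) hy, comm_apply hx (𝒜.d_mem hy), map_sub, e0,
    𝒜.d_mul hx, 𝒜.d_mul hy, add_mul, mul_add, one_mul, mul_one, Int.negOnePow_add,
    Int.negOnePow_add]
  rcases Int.units_eq_one_or (i * j).negOnePow with e | e <;>
  rcases Int.units_eq_one_or i.negOnePow with e' | e' <;>
  rcases Int.units_eq_one_or j.negOnePow with e'' | e'' <;>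
  simp only [e, e', e'', one_smul, mul_one, Units.neg_smul, neg_neg, mul_neg] <;>
  noncomm_ring

/-- To check a linear condition on a homogeneous subspace, homogeneous elements suffice. -/
theorem induction_homogeneous {N M : Submodule K A} (hN : DirectSum.SetLike.IsHomogeneous 𝒜.gr N)
    (h : ∀ (i : ℤ) (x : A), x ∈ 𝒜.gr i → x ∈ N → x ∈ M) : N ≤ M :=
  ((isHomogeneous_iff_le_iSup 𝒜.gr N).1 hN).trans
    (iSup_le fun i _ hx => h i _ hx.2 hx.1)

theorem isHomogeneous_top : DirectSum.SetLike.IsHomogeneous 𝒜.gr (⊤ : Submodule K A) :=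
  fun _ _ _ => Submodule.mem_top

theorem comm_R (x : A) : 𝒜.comm 𝒜.R x = 𝒜.R * x - x * 𝒜.R := by
  have : (⊤ : Submodule K A) ≤ LinearMap.eqLocus (𝒜.comm 𝒜.R)
      (LinearMap.mulLeft K 𝒜.R - LinearMap.mulRight K 𝒜.R) := by
    refine induction_homogeneous (𝒜 := 𝒜) isHomogeneous_top fun i x hx _ => ?_
    simp [LinearMap.mem_eqLocus, comm_apply 𝒜.R_mem hx]
  simpa using this (Submodule.mem_top (x := x))

theorem isHomogeneous_mul {N P : Submodule K A} (hN : DirectSum.SetLike.IsHomogeneous 𝒜.gr N)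
    (hP : DirectSum.SetLike.IsHomogeneous 𝒜.gr P) : DirectSum.SetLike.IsHomogeneous 𝒜.gr (N * P) := by
  rw [isHomogeneous_iff_le_iSup] at *
  refine (mul_le_mul' hN hP).trans ?_
  rw [Submodule.iSup_mul]
  refine iSup_le fun i => ?_
  rw [Submodule.mul_iSup]
  refine iSup_le fun j => ?_
  refine le_trans ?_ (le_iSup (fun n => N * P ⊓ 𝒜.gr n) (i + j))
  rw [Submodule.mul_le]
  exact fun x hx y hy =>
    ⟨Submodule.mul_mem_mul hx.1 hy.1, SetLike.mul_mem_graded hx.2 hy.2⟩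

theorem d_mem_mul {N P : Submodule K A} (hN : DirectSum.SetLike.IsHomogeneous 𝒜.gr N)
    (dN : ∀ x ∈ N, 𝒜.d x ∈ N) (dP : ∀ x ∈ P, 𝒜.d x ∈ P) : ∀ x ∈ N * P, 𝒜.d x ∈ N * P := by
  have key : ∀ y ∈ P, N ≤ (N * P).comap (𝒜.d ∘ₗ LinearMap.mulRight K y) := by
    intro y hy
    refine induction_homogeneous hN fun i x hx hxN => ?_
    simp only [Submodule.mem_comap, LinearMap.comp_apply, LinearMap.mulRight_apply, 𝒜.d_mul hx]
    have h1 := Submodule.mul_mem_mul (dN x hxN) hy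
    have h2 := Submodule.mul_mem_mul hxN (dP y hy)
    refine Submodule.add_mem _ h1 ?_
    rcases Int.units_eq_one_or i.negOnePow with e | e <;> simpa [e] using h2
  have : N * P ≤ (N * P).comap 𝒜.d := by
    rw [Submodule.mul_le]
    exact fun x hx y hy => key y hy hx
  exact this

variable (𝒜) in
/-- `[A, A]`: the linear span of all graded commutators. -/
noncomputable def commSpan : Submodule K A :=
  Submodule.span K {z | ∃ x y, z = 𝒜.comm x y}

end CurvedDGAlgebra

/-- A curved Lie ideal `I` of a curved DG-algebra: a homogeneous Lie ideal (for the graded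
commutator) with `d(I) ⊆ I` and `R ∈ I`. -/
structure CurvedLieIdeal {K A : Type*} [Field K] [Ring A] [Algebra K A]
    (𝒜 : CurvedDGAlgebra K A) where
  carrier : Submodule K A
  homogeneous : DirectSum.SetLike.IsHomogeneous 𝒜.gr carrier
  comm_mem : ∀ (a : A) {x : A}, x ∈ carrier → 𝒜.comm a x ∈ carrier
  d_mem : ∀ x ∈ carrier, 𝒜.d x ∈ carrier
  R_mem : 𝒜.R ∈ carrier

namespace CurvedLieIdeal

open CurvedDGAlgebra

variable {K A : Type*} [Field K] [Ring A] [Algebra K A] {𝒜 : CurvedDGAlgebra K A}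
  (I : CurvedLieIdeal 𝒜)

theorem comm_mem_left {x : A} (hx : x ∈ I.carrier) (a : A) : 𝒜.comm x a ∈ I.carrier := by
  have h1 : I.carrier ≤ I.carrier.comap (𝒜.comm.flip a) := by
    refine induction_homogeneous I.homogeneous fun i x hxi hx => ?_
    have h2 : (⊤ : Submodule K A) ≤ I.carrier.comap (𝒜.comm x) := by
      refine induction_homogeneous (𝒜 := 𝒜) isHomogeneous_top fun j a ha _ => ?_
      have h3 := I.comm_mem a hx
      rw [Submodule.mem_comap, comm_antisymm hxi ha]
      rcases Int.units_eq_one_or (i * j).negOnePow with e | e <;> simpa [e] using h3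
    exact h2 (Submodule.mem_top (x := a))
  exact h1 hx

/-- The bracket on `A ⧸ I` induced by the graded commutator of `A`. -/
noncomputable def quotientBracket :
    (A ⧸ I.carrier) →ₗ[K] (A ⧸ I.carrier) →ₗ[K] (A ⧸ I.carrier) :=
  (I.carrier.liftQ
    (I.carrier.liftQ (𝒜.comm.compr₂ I.carrier.mkQ) (by
      intro x hx
      rw [LinearMap.mem_ker]
      ext a
      exact (Submodule.Quotient.mk_eq_zero _).2 (I.comm_mem_left hx a))).flip (by
    intro x hx
    rw [LinearMap.mem_ker]
    refine Submodule.linearMap_qext _ ?_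
    ext a
    exact (Submodule.Quotient.mk_eq_zero _).2 (I.comm_mem a hx))).flip

theorem quotientBracket_mk (x y : A) :
    I.quotientBracket (I.carrier.mkQ x) (I.carrier.mkQ y) = I.carrier.mkQ (𝒜.comm x y) := rfl

/-- The DG-Lie algebra `A / I`. -/
noncomputable def quotient : DGLieAlgebra K (A ⧸ I.carrier) where
  gr n := (𝒜.gr n).map I.carrier.mkQ
  decomposition := (isInternal_quotient 𝒜.gr I.carrier I.homogeneous).chooseDecomposition
  d := I.carrier.mapQ I.carrier 𝒜.d I.d_mem
  d_mem := by
    rintro n _ ⟨x, hx, rfl⟩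
    exact ⟨𝒜.d x, 𝒜.d_mem hx, rfl⟩
  d_d x := by
    obtain ⟨x, rfl⟩ := I.carrier.mkQ_surjective x
    have h := I.comm_mem_left I.R_mem x
    rw [comm_R, ← 𝒜.d_d] at h
    exact (Submodule.Quotient.mk_eq_zero _).2 h
  bracket := I.quotientBracket
  bracket_mem := by
    rintro i j _ _ ⟨x, hx, rfl⟩ ⟨y, hy, rfl⟩
    exact ⟨𝒜.comm x y, CurvedDGAlgebra.comm_mem hx hy, rfl⟩
  antisymm := by
    rintro i j _ _ ⟨x, hx, rfl⟩ ⟨y, hy, rfl⟩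
    rw [quotientBracket_mk, quotientBracket_mk, comm_antisymm hx hy]
    rfl
  jacobi := by
    rintro i j l _ _ _ ⟨x, hx, rfl⟩ ⟨y, hy, rfl⟩ ⟨z, hz, rfl⟩
    simp only [quotientBracket_mk]
    rw [comm_jacobi hx hy hz]
    rfl
  leibniz := by
    rintro i j _ _ ⟨x, hx, rfl⟩ ⟨y, hy, rfl⟩
    have e : ∀ z, I.carrier.mapQ I.carrier 𝒜.d I.d_mem (I.carrier.mkQ z) =
      I.carrier.mkQ (𝒜.d z) := fun _ => rfl
    simp only [quotientBracket_mk, e]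
    rw [d_comm hx hy]
    rfl

/-- `I^{(k)} A`: the linear span of all products `e₁ ⋯ e_k a` with `e₁, …, e_k ∈ I`, `a ∈ A`
(products and powers of subspaces are the spans of the products of their elements). -/
def powMul (k : ℕ) : Submodule K A := I.carrier ^ k * ⊤

theorem powMul_succ_homogeneous (k : ℕ) : DirectSum.SetLike.IsHomogeneous 𝒜.gr (I.powMul (k + 1)) := by
  refine isHomogeneous_mul ?_ isHomogeneous_top
  induction k with
  | zero => simpa using I.homogeneous
  | succ k ih => exact pow_succ I.carrier (k + 1) ▸ isHomogeneous_mul ih I.homogeneous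

theorem d_mem_powMul_succ (k : ℕ) : ∀ x ∈ I.powMul (k + 1), 𝒜.d x ∈ I.powMul (k + 1) := by
  have h : DirectSum.SetLike.IsHomogeneous 𝒜.gr (I.carrier ^ (k + 1)) ∧
      ∀ x ∈ I.carrier ^ (k + 1), 𝒜.d x ∈ I.carrier ^ (k + 1) := by
    induction k with
    | zero => simpa using ⟨I.homogeneous, I.d_mem⟩
    | succ k ih =>
      rw [pow_succ]
      exact ⟨isHomogeneous_mul ih.1 I.homogeneous, d_mem_mul ih.1 ih.2 I.d_mem⟩
  exact d_mem_mul h.1 h.2 fun _ _ => Submodule.mem_top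

end CurvedLieIdeal

/-- A trace map `Tr : A → C` from a curved DG-algebra to a complex: a degree-preserving linear map
with `Tr ∘ d = δ ∘ Tr` and `Tr([A, A]) = 0`. -/
structure TraceMap {K A C : Type*} [Field K] [Ring A] [Algebra K A] [AddCommGroup C] [Module K C]
    (𝒜 : CurvedDGAlgebra K A) (𝒞 : DGSpace K C) where
  toLin : A →ₗ[K] C
  map_mem : ∀ {n : ℤ} {x : A}, x ∈ 𝒜.gr n → toLin x ∈ 𝒞.gr n
  map_d : ∀ x, toLin (𝒜.d x) = 𝒞.d (toLin x)
  map_comm : ∀ x ∈ 𝒜.commSpan, toLin x = 0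

namespace TraceMap

variable {K A C : Type*} [Field K] [Ring A] [Algebra K A] [AddCommGroup C] [Module K C]
  {𝒜 : CurvedDGAlgebra K A} {𝒞 : DGSpace K C} (Tr : TraceMap 𝒜 𝒞)

theorem map_homogeneous {N : Submodule K A} (hN : DirectSum.SetLike.IsHomogeneous 𝒜.gr N) :
    DirectSum.SetLike.IsHomogeneous 𝒞.gr (N.map Tr.toLin) := by
  rw [isHomogeneous_iff_le_iSup] at *
  refine (Submodule.map_mono hN).trans ?_
  rw [Submodule.map_iSup]
  refine iSup_mono fun n => ?_
  rintro _ ⟨x, hx, rfl⟩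
  exact ⟨Submodule.mem_map_of_mem hx.1, Tr.map_mem hx.2⟩

/-- The subspace `Tr(I^{(k)} A)` of `C`. -/
def image (I : CurvedLieIdeal 𝒜) (k : ℕ) : Submodule K C := (I.powMul k).map Tr.toLin

/-- The quotient complex `C / Tr(I^{(k+1)} A)`. -/
noncomputable def quotient (I : CurvedLieIdeal 𝒜) (k : ℕ) :
    DGSpace K (C ⧸ Tr.image I (k + 1)) :=
  𝒞.quotient (Tr.image I (k + 1)) (Tr.map_homogeneous (I.powMul_succ_homogeneous k)) (by
    rintro _ ⟨x, hx, rfl⟩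
    exact ⟨𝒜.d x, I.d_mem_powMul_succ k x hx, Tr.map_d x⟩)

end TraceMap

/-! ### `L∞` morphisms of DG-Lie algebras

For a DG-Lie algebra `L`, the symmetric coalgebra `S(L[1])` carries the codifferential with Taylor
coefficients `q₁(x) = -d x`, `q₂(x, y) = (-1)^{|x|} [x, y]`, with `|x|` the degree in `L`; an element
of degree `a` in `L` has degree `a - 1` in `L[1]`. An `L∞` morphism `L ⇝ M` is a morphism of
DG-coalgebras `S(L[1]) → S(M[1])`, given here by its Taylor coefficients. -/

/-- The Koszul sign `ε(σ)`, defined by `x_{σ(1)} ⊙ ⋯ ⊙ x_{σ(n)} = ε(σ) x_1 ⊙ ⋯ ⊙ x_n` for elements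
`x_i` of degrees `b i`: a factor `(-1)^{b_{σ(i)} b_{σ(j)}}` for each inversion of `σ`. -/
def koszulSign {n : ℕ} (b : Fin n → ℤ) (σ : Equiv.Perm (Fin n)) : ℤˣ :=
  ∏ i : Fin n, ∏ j : Fin n, if i < j ∧ σ j < σ i then (b (σ i) * b (σ j)).negOnePow else 1

/-- `(p, n-p)`-unshuffles: permutations that increase on the first `p` and on the last `n - p`
indices. -/
def IsUnshuffle {n : ℕ} (p : ℕ) (σ : Equiv.Perm (Fin n)) : Prop :=
  ∀ i j : Fin n, i < j → (j.val < p ∨ p ≤ i.val) → σ i < σ j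

instance {n : ℕ} (p : ℕ) (σ : Equiv.Perm (Fin n)) : Decidable (IsUnshuffle p σ) := by
  unfold IsUnshuffle; infer_instance

namespace DGLieAlgebra

variable {K V W : Type*} [Field K] [AddCommGroup V] [Module K V] [AddCommGroup W] [Module K W]

/-- `q₁(x) = -d x`. -/
def q₁ (L : DGLieAlgebra K V) (x : V) : V := -L.d x

/-- `q₂(x, y) = (-1)^{|x|} [x, y]` for `x` of degree `a` in `L`. -/
def q₂ (L : DGLieAlgebra K V) (a : ℤ) (x y : V) : V := a.negOnePow • L.bracket x y

/-- `f ∘ Q₀`, for `f` of arity `n`, evaluated on `x_1 ⊙ ⋯ ⊙ x_n` with `x_i` of degree `a i` in `L`: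
the sum over `i` of `(-1)^{∑_{j<i} (a_j - 1)} f(x_1, …, q₁ x_i, …, x_n)`. -/
def compQ₀ (L : DGLieAlgebra K V) {n : ℕ} (f : MultilinearMap K (fun _ : Fin n => V) W)
    (a : Fin n → ℤ) (x : Fin n → V) : W :=
  ∑ i, (∑ j ∈ Finset.univ.filter (· < i), (a j - 1)).negOnePow •
    f (Function.update x i (L.q₁ (x i)))

/-- `f ∘ Q₁` evaluated on `x_1 ⊙ ⋯ ⊙ x_n`: the sum over the `(2, n-2)`-unshuffles `σ` of
`ε(σ) f_{n-1}(q₂(x_{σ(1)}, x_{σ(2)}), x_{σ(3)}, …, x_{σ(n)})`; it is zero for `n < 2`. -/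
def compQ₁ (L : DGLieAlgebra K V) (f : (n : ℕ) → MultilinearMap K (fun _ : Fin n => V) W) :
    (n : ℕ) → (Fin n → ℤ) → (Fin n → V) → W
  | 0, _, _ => 0
  | 1, _, _ => 0
  | m + 2, a, x =>
    ∑ σ ∈ Finset.univ.filter (fun σ : Equiv.Perm (Fin (m + 2)) => IsUnshuffle 2 σ),
      koszulSign (fun i => a i - 1) σ •
        f (m + 1) (Fin.cons (L.q₂ (a (σ 0)) (x (σ 0)) (x (σ 1)))
          (fun i : Fin m => x (σ i.succ.succ)))

/-- `q₂ ∘ F` evaluated on `x_1 ⊙ ⋯ ⊙ x_n`, for `F` with Taylor coefficients `f` and `q₂` of the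
target `M`: one half of the sum over `p + q = n` and over the `(p, q)`-unshuffles `σ` of
`ε(σ) q₂(f_p(x_{σ(1)}, …, x_{σ(p)}), f_q(x_{σ(p+1)}, …, x_{σ(n)}))`. In `M` the first argument has
degree `∑_{i ≤ p} (a_{σ(i)} - 1) + 1`. -/
def q₂Comp (M : DGLieAlgebra K W) (f : (n : ℕ) → MultilinearMap K (fun _ : Fin n => V) W)
    (n : ℕ) (a : Fin n → ℤ) (x : Fin n → V) : W :=
  (1 / 2 : K) • ∑ p : Fin (n + 1),
    ∑ σ ∈ Finset.univ.filter (fun σ : Equiv.Perm (Fin n) => IsUnshuffle p.val σ),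
      koszulSign (fun i => a i - 1) σ •
        M.q₂ (∑ i : Fin p.val, (a (σ (Fin.castLE p.is_le i)) - 1) + 1)
          (f p.val fun i => x (σ (Fin.castLE p.is_le i)))
          (f (n - p.val) fun i => x (σ ⟨p.val + i.val, by omega⟩))

end DGLieAlgebra

/-- An `L∞` morphism `L ⇝ M` of DG-Lie algebras (over a field of characteristic zero): a sequence of
graded symmetric multilinear maps `coeff n : L[1]^{⊙ n} → M[1]`, `n ≥ 1`, of degree zero, that is the
sequence of Taylor coefficients of a morphism of DG-coalgebras `S(L[1]) → S(M[1])`. -/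
structure LInfinityMorphism {K V W : Type*} [Field K] [CharZero K] [AddCommGroup V] [Module K V]
    [AddCommGroup W] [Module K W] (L : DGLieAlgebra K V) (M : DGLieAlgebra K W) where
  coeff : (n : ℕ) → MultilinearMap K (fun _ : Fin n => V) W
  coeff_zero : coeff 0 = 0
  coeff_mem : ∀ (n : ℕ) (a : Fin n → ℤ) (x : Fin n → V), (∀ i, x i ∈ L.gr (a i)) →
    coeff n x ∈ M.gr (∑ i, (a i - 1) + 1)
  coeff_symm : ∀ (n : ℕ) (a : Fin n → ℤ) (x : Fin n → V), (∀ i, x i ∈ L.gr (a i)) →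
    ∀ σ : Equiv.Perm (Fin n),
      coeff n (fun i => x (σ i)) = koszulSign (fun i => a i - 1) σ • coeff n x
  /-- Compatibility with the codifferentials. -/
  compat : ∀ (n : ℕ) (a : Fin n → ℤ) (x : Fin n → V), (∀ i, x i ∈ L.gr (a i)) →
    M.q₁ (coeff n x) + M.q₂Comp coeff n a x = L.compQ₀ (coeff n) a x + L.compQ₁ coeff n a x

/-! The morphism is a Chern-Simons form. Put `L = A/I` and consider cochains on the bar construction
of `L` with values in `A`. Under convolution they form a ring, with the derivation `D g = d ∘ g -
(-1)^{|g|} g ∘ Q`, where `Q` is the codifferential. A graded linear section `S : A/I → A` of the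
projection, seen as a cochain `s` supported on words of length one, has degree one and plays the
role of a connection. It satisfies `D (D s) = [R, s]`. Along the path `t s` the curvature is `F_t =
R + t D s + t² s²`.

Two facts carry the proof. First, `F_1` takes all its values in `I`: its components are `R`, the
failure of `S` to commute with the differentials and, up to sign, its failure to respect the
brackets (`curvature_apply_mem`). Hence the traces of `F_1^{k+1}` and of `F_0^{k+1} = R^{k+1}`
vanish modulo `Tr(I^{(k+1)} A)`. Second, the Bianchi identity `D F_t = [F_t, t s]` and the cyclicity
of the trace give (`transgression`) `D ∫₀¹ Tr(s F_t^k) dt = (1/(k+1)) (Tr F_1^{k+1} - Tr R^{k+1})`.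
So `(1/k!) ∫₀¹ Tr(s F_t^k) dt` is closed in the quotient. A closed form of degree `1 + 2k` is an
`L∞` morphism to the abelian DG-Lie algebra shifted by `2k` (`IsForm.toLInfinityMorphism`). On one
letter `x` only the value `R^k` of `F_t^k` on the empty word contributes, which leaves `(1/k!)
Tr(S(x) R^k)`. Replacing `S(x)` by a representative of `x` changes this only by the trace of an
element of `I^{k+1}`.

Cochains are arbitrary functions on words of homogeneous elements. Convolution and coderivations are
defined by recursion on the first letter, so ring identities and sign rules follow by induction on
words. Symmetry and multilinearity are imposed by `IsForm`, and unshuffles appear only in the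
comparison with the definition of an `L∞` morphism. -/

/-! ### Koszul signs -/

/-- The sign `(-1)^{pq}`, as a function of the parities `u = (-1)^p` and `v = (-1)^q`. -/
def koszul (u v : ℤˣ) : ℤˣ := if u = -1 then v else 1

@[simp] theorem koszul_one_left (v : ℤˣ) : koszul 1 v = 1 := rfl
@[simp] theorem koszul_neg_one_left (v : ℤˣ) : koszul (-1) v = v := rfl

@[simp] theorem koszul_one_right (u : ℤˣ) : koszul u 1 = 1 := by
  rcases Int.units_eq_one_or u with rfl | rfl <;> rfl

@[simp] theorem koszul_neg_one_right (u : ℤˣ) : koszul u (-1) = u := by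
  rcases Int.units_eq_one_or u with rfl | rfl <;> rfl

theorem koszul_comm (u v : ℤˣ) : koszul u v = koszul v u := by
  rcases Int.units_eq_one_or u with rfl | rfl <;> simp

theorem koszul_mul_left (u u' v : ℤˣ) : koszul (u * u') v = koszul u v * koszul u' v := by
  rcases Int.units_eq_one_or u with rfl | rfl <;> rcases Int.units_eq_one_or u' with rfl | rfl <;>
  simp

theorem koszul_mul_right (u v v' : ℤˣ) : koszul u (v * v') = koszul u v * koszul u v' := by
  rw [koszul_comm, koszul_mul_left, koszul_comm v, koszul_comm v']

theorem koszul_negOnePow (a b : ℤ) : koszul a.negOnePow b.negOnePow = (a * b).negOnePow := by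
  rcases Int.even_or_odd a with ha | ha
  · rw [Int.negOnePow_even _ ha, Int.negOnePow_even _ (ha.mul_right b), koszul_one_left]
  · rw [Int.negOnePow_odd _ ha, koszul_neg_one_left]
    rcases Int.even_or_odd b with hb | hb
    · rw [Int.negOnePow_even _ hb, Int.negOnePow_even _ (hb.mul_left a)]
    · rw [Int.negOnePow_odd _ hb, Int.negOnePow_odd _ (ha.mul hb)]

theorem map_units_int_smul {M N F : Type*} [AddCommGroup M] [AddCommGroup N] [FunLike F M N]
    [AddMonoidHomClass F M N] (f : F) (u : ℤˣ) (x : M) : f (u • x) = u • f x := by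
  rcases Int.units_eq_one_or u with rfl | rfl <;> simp

theorem units_int_smul_mem {M S : Type*} [AddCommGroup M] [SetLike S M] [AddSubgroupClass S M]
    {N : S} (u : ℤˣ) {x : M} (hx : x ∈ N) : u • x ∈ N := by
  rcases Int.units_eq_one_or u with rfl | rfl <;> simpa using hx

theorem units_int_smul_mul {A : Type*} [Ring A] (u : ℤˣ) (x y : A) : u • x * y = u • (x * y) := by
  rcases Int.units_eq_one_or u with rfl | rfl <;> simp

theorem mul_units_int_smul {A : Type*} [Ring A] (u : ℤˣ) (x y : A) : x * u • y = u • (x * y) := by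
  rcases Int.units_eq_one_or u with rfl | rfl <;> simp

/-! ### The convolution ring of cochains

A cochain is a function on words in the letters `H`; every letter has a parity. Words are the
basis of the tensor coalgebra with the unshuffle coproduct, and cochains with values in a ring
with parity operator form a ring under convolution. -/

section Words

variable {H M : Type*}

/-- Evaluation of a cochain at a first letter. -/
def contract (x : H) (g : List H → M) : List H → M := fun w => g (x :: w)

theorem contract_apply (x : H) (g : List H → M) (w : List H) : contract x g w = g (x :: w) := rfl

variable (par : H → ℤˣ)

/-- The parity of a word. -/
def wordParity (w : List H) : ℤˣ := (w.map par).prod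

@[simp] theorem wordParity_nil : wordParity par [] = 1 := rfl

@[simp] theorem wordParity_cons (x : H) (w : List H) :
    wordParity par (x :: w) = par x * wordParity par w := by simp [wordParity]

end Words

section Convolution

variable {H A : Type*} [Ring A] (par : H → ℤˣ) (θ : ℤˣ →* (A →+* A))

/-- The sign of moving an operator of parity `u` past a cochain. -/
def twist (u : ℤˣ) (g : List H → A) : List H → A :=
  fun w => koszul u (wordParity par w) • θ u (g w)

theorem twist_add (u : ℤˣ) (g h : List H → A) :
    twist par θ u (g + h) = twist par θ u g + twist par θ u h := by
  ext w; simp [twist]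

theorem twist_one (g : List H → A) : twist par θ 1 g = g := by
  ext w; simp [twist]

theorem twist_twist (u v : ℤˣ) (g : List H → A) :
    twist par θ u (twist par θ v g) = twist par θ (u * v) g := by
  ext w; simp [twist, koszul_mul_left, mul_smul]

theorem contract_twist (u : ℤˣ) (x : H) (g : List H → A) :
    contract x (twist par θ u g) = koszul u (par x) • twist par θ u (contract x g) := by
  ext w; simp [twist, contract, koszul_mul_right, mul_smul]

/-- Convolution of cochains. -/
def conv : List H → (List H → A) → (List H → A) → A
  | [], g, h => g [] * h []
  | x :: w, g, h => conv w (contract x g) (twist par θ (par x) h) + conv w g (contract x h)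

theorem conv_add_left (w : List H) (g g' h : List H → A) :
    conv par θ w (g + g') h = conv par θ w g h + conv par θ w g' h := by
  induction w generalizing g g' h with
  | nil => simp [conv, add_mul]
  | cons x w ih =>
    have e : contract x (g + g') = contract x g + contract x g' := rfl
    simp only [conv, e, ih]
    abel

theorem conv_add_right (w : List H) (g h h' : List H → A) :
    conv par θ w g (h + h') = conv par θ w g h + conv par θ w g h' := by
  induction w generalizing g h h' with
  | nil => simp [conv, mul_add]
  | cons x w ih =>
    have e : contract x (h + h') = contract x h + contract x h' := rfl
    simp only [conv, e, twist_add, ih]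
    abel

theorem conv_zero_left (w : List H) (h : List H → A) : conv par θ w 0 h = 0 := by
  have := conv_add_left par θ w 0 0 h
  simpa using this

theorem conv_zero_right (w : List H) (g : List H → A) : conv par θ w g 0 = 0 := by
  have := conv_add_right par θ w g 0 0
  simpa using this

theorem conv_smul_left {K : Type*} [CommRing K] [Algebra K A] (c : K) (w : List H)
    (g h : List H → A) : conv par θ w (c • g) h = c • conv par θ w g h := by
  induction w generalizing g h with
  | nil => simp [conv]
  | cons x w ih =>
    have e : contract x (c • g) = c • contract x g := rfl
    simp only [conv, e, ih, smul_add]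

theorem conv_smul_right {K : Type*} [CommRing K] [Algebra K A]
    (hθ : ∀ u (c : K) x, θ u (c • x) = c • θ u x) (c : K) (w : List H)
    (g h : List H → A) : conv par θ w g (c • h) = c • conv par θ w g h := by
  induction w generalizing g h with
  | nil => simp [conv]
  | cons x w ih =>
    have e : contract x (c • h) = c • contract x h := rfl
    have e' : twist par θ (par x) (c • h) = c • twist par θ (par x) h := by
      ext v
      simp only [twist, Pi.smul_apply, hθ]
      rcases Int.units_eq_one_or (koszul (par x) (wordParity par v)) with h | h <;> simp [h]
    simp only [conv, e, e', ih, smul_add]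

/-- Cochains with values in `A`, as a type that carries the convolution product. -/
@[ext] structure Cochain (par : H → ℤˣ) (θ : ℤˣ →* (A →+* A)) where
  /-- The underlying function on words. -/
  toFun : List H → A

namespace Cochain

variable {par θ}

instance : CoeFun (Cochain par θ) (fun _ => List H → A) := ⟨toFun⟩

/-- Cochains as functions on words. -/
def equivFun : Cochain par θ ≃ (List H → A) := ⟨toFun, mk, fun _ => rfl, fun _ => rfl⟩

instance : AddCommGroup (Cochain par θ) := equivFun.addCommGroup

instance : Mul (Cochain par θ) := ⟨fun g h => ⟨fun w => conv par θ w g h⟩⟩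

/-- The cochain with the value `a` on the empty word. -/
def const (a : A) : Cochain par θ where
  toFun
    | [] => a
    | _ :: _ => 0

instance : One (Cochain par θ) := ⟨const 1⟩

theorem ext_apply {g h : Cochain par θ} (e : ∀ w : List H, g w = h w) : g = h :=
  Cochain.ext (funext e)

theorem add_apply (g h : Cochain par θ) (w : List H) : (g + h) w = g w + h w := rfl
theorem neg_apply (g : Cochain par θ) (w : List H) : (-g) w = -g w := rfl
theorem sub_apply (g h : Cochain par θ) (w : List H) : (g - h) w = g w - h w := rfl
theorem zero_apply (w : List H) : (0 : Cochain par θ) w = 0 := rfl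
@[simp] theorem const_nil (a : A) : (const a : Cochain par θ) [] = a := rfl
@[simp] theorem const_cons (a : A) (x : H) (w : List H) :
    (const a : Cochain par θ) (x :: w) = 0 := rfl

/-- Evaluation at a first letter. -/
def ctr (x : H) (g : Cochain par θ) : Cochain par θ := ⟨contract x g⟩

/-- The action of signs on cochains. -/
def tw (u : ℤˣ) (g : Cochain par θ) : Cochain par θ := ⟨twist par θ u g⟩

theorem tw_apply (u : ℤˣ) (g : Cochain par θ) (w : List H) :
    tw u g w = koszul u (wordParity par w) • θ u (g w) := rfl

@[simp] theorem mul_nil (g h : Cochain par θ) : (g * h) [] = g [] * h [] := rfl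

theorem mul_cons (g h : Cochain par θ) (x : H) (w : List H) :
    (g * h) (x :: w) = (ctr x g * tw (par x) h) w + (g * ctr x h) w := rfl

theorem ctr_apply (x : H) (g : Cochain par θ) (w : List H) : ctr x g w = g (x :: w) := rfl

theorem ctr_add (x : H) (g h : Cochain par θ) : ctr x (g + h) = ctr x g + ctr x h := rfl

/-- Contraction is a skew derivation, true by definition of `conv`: a letter that enters `g` first
passes `h`, with sign `(-1)^{|x||h|}`. The inductions on words below rest on this rule. -/
theorem ctr_mul (x : H) (g h : Cochain par θ) :
    ctr x (g * h) = ctr x g * tw (par x) h + g * ctr x h := rfl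

theorem tw_add (u : ℤˣ) (g h : Cochain par θ) : tw u (g + h) = tw u g + tw u h :=
  Cochain.ext (twist_add par θ u g h)

@[simp] theorem tw_one (g : Cochain par θ) : tw 1 g = g := Cochain.ext (twist_one par θ g)

theorem tw_tw (u v : ℤˣ) (g : Cochain par θ) : tw u (tw v g) = tw (u * v) g :=
  Cochain.ext (twist_twist par θ u v g)

theorem units_smul_apply (u : ℤˣ) (g : Cochain par θ) (w : List H) : (u • g) w = u • g w := by
  rcases Int.units_eq_one_or u with rfl | rfl <;> simp [neg_apply]

theorem ctr_tw (u : ℤˣ) (x : H) (g : Cochain par θ) :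
    ctr x (tw u g) = koszul u (par x) • tw u (ctr x g) :=
  ext_apply fun w => by
    rw [units_smul_apply]
    exact congrFun (contract_twist par θ u x g) w

instance : NonUnitalNonAssocRing (Cochain par θ) where
  left_distrib a b c := ext_apply fun w => conv_add_right par θ w a b c
  right_distrib a b c := ext_apply fun w => conv_add_left par θ w a b c
  zero_mul a := ext_apply fun w => conv_zero_left par θ w a
  mul_zero a := ext_apply fun w => conv_zero_right par θ w a

theorem units_smul_mul (u : ℤˣ) (g h : Cochain par θ) : u • g * h = u • (g * h) := by
  rcases Int.units_eq_one_or u with rfl | rfl <;> simp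

theorem mul_units_smul (u : ℤˣ) (g h : Cochain par θ) : g * u • h = u • (g * h) := by
  rcases Int.units_eq_one_or u with rfl | rfl <;> simp

theorem tw_mul (u : ℤˣ) (g h : Cochain par θ) : tw u (g * h) = tw u g * tw u h := by
  refine ext_apply fun w => ?_
  induction w generalizing g h with
  | nil => simp [tw_apply]
  | cons x w ih =>
    rw [← ctr_apply, ctr_tw, units_smul_apply, ctr_mul, tw_add, add_apply, ih, ih, mul_cons, ctr_tw,
      ctr_tw, units_smul_mul, mul_units_smul, units_smul_apply, units_smul_apply, tw_tw, tw_tw,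
      mul_comm u, smul_add]

theorem tw_const_one (u : ℤˣ) : tw u (const 1 : Cochain par θ) = const 1 := by
  refine ext_apply fun w => ?_
  cases w <;> simp [tw_apply]

theorem ctr_const (x : H) (a : A) : ctr x (const a : Cochain par θ) = 0 := rfl

instance : Ring (Cochain par θ) where
  __ := (inferInstance : NonUnitalNonAssocRing (Cochain par θ))
  mul_assoc a b c := by
    refine ext_apply fun w => ?_
    induction w generalizing a b c with
    | nil => simp [mul_assoc]
    | cons x w ih =>
      simp only [← ctr_apply, ctr_mul, add_mul, mul_add, tw_mul, add_apply, ih]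
      abel
  one_mul a := by
    change const 1 * a = a
    refine ext_apply fun w => ?_
    induction w generalizing a with
    | nil => simp
    | cons x w ih => rw [mul_cons, ih, ctr_const, zero_mul, zero_apply, zero_add, ctr_apply]
  mul_one a := by
    change a * const 1 = a
    refine ext_apply fun w => ?_
    induction w generalizing a with
    | nil => simp
    | cons x w ih =>
      rw [mul_cons, tw_const_one, ih, ctr_const, mul_zero, zero_apply, add_zero, ctr_apply]

theorem one_cons (x : H) (w : List H) : (1 : Cochain par θ) (x :: w) = 0 := rfl

@[simp] theorem one_nil : (1 : Cochain par θ) [] = 1 := rfl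

end Cochain

end Convolution

/-! ### Coderivations of words, and derivations of the convolution ring -/

section Coderivations

variable {H M N : Type*} [AddCommGroup M] [AddCommGroup N] (par : H → ℤˣ)

/-- Composition of a cochain with the coderivation that applies `φ`, of parity `m`, to one letter
of a word. -/
def coder (φ : H → H) (m : ℤˣ) : List H → (List H → M) → M
  | [], _ => 0
  | y :: w, f => f (φ y :: w) + koszul m (par y) • coder φ m w (contract y f)

/-- Composition of a cochain with the coderivation of odd parity that brackets two letters of a
word. -/
def coderBr (q : H → H → H) : List H → (List H → M) → M
  | [], _ => 0
  | x :: w, f => coder par (q x) (-par x) w f + par x • coderBr q w (contract x f)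

theorem coder_map (φ : H → H) (m : ℤˣ) (T : M →+ N) (w : List H) (f : List H → M) :
    coder par φ m w (fun v => T (f v)) = T (coder par φ m w f) := by
  induction w generalizing f with
  | nil => simp [coder]
  | cons y w ih =>
    rw [coder, coder, map_add, map_units_int_smul, ← ih]
    rfl

theorem coderBr_map (q : H → H → H) (T : M →+ N) (w : List H) (f : List H → M) :
    coderBr par q w (fun v => T (f v)) = T (coderBr par q w f) := by
  induction w generalizing f with
  | nil => simp [coderBr]
  | cons y w ih =>
    rw [coderBr, coderBr, map_add, map_units_int_smul, ← ih, coder_map]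
    rfl

theorem coder_add (φ : H → H) (m : ℤˣ) (w : List H) (f g : List H → M) :
    coder par φ m w (f + g) = coder par φ m w f + coder par φ m w g := by
  induction w generalizing f g with
  | nil => simp [coder]
  | cons y w ih =>
    have e : contract y (f + g) = contract y f + contract y g := rfl
    simp only [coder, e, ih, Pi.add_apply, smul_add]
    abel

theorem coderBr_add (q : H → H → H) (w : List H) (f g : List H → M) :
    coderBr par q w (f + g) = coderBr par q w f + coderBr par q w g := by
  induction w generalizing f g with
  | nil => simp [coderBr]
  | cons y w ih =>
    have e : contract y (f + g) = contract y f + contract y g := rfl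
    simp only [coderBr, e, ih, coder_add, smul_add]
    abel

theorem coder_eq_zero (φ : H → H) (m : ℤˣ) (w : List H) (f : List H → M)
    (hf : ∀ v : List H, v.length = w.length → f v = 0) : coder par φ m w f = 0 := by
  induction w generalizing f with
  | nil => rfl
  | cons y w ih =>
    simp only [coder]
    rw [hf _ (by simp), ih, smul_zero, add_zero]
    exact fun v hv => hf _ (by simp [hv])

theorem coderBr_eq_zero (q : H → H → H) (w : List H) (f : List H → M)
    (hf : ∀ v : List H, v.length + 1 = w.length → f v = 0) : coderBr par q w f = 0 := by
  induction w generalizing f with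
  | nil => rfl
  | cons y w ih =>
    simp only [coderBr]
    rw [coder_eq_zero, ih, smul_zero, add_zero]
    · exact fun v hv => hf _ (by simp [← hv])
    · exact fun v hv => hf _ (by simp [hv])

end Coderivations

namespace Cochain

variable {H A : Type*} [Ring A] {par : H → ℤˣ} {θ : ℤˣ →* (A →+* A)}

/-- Composition with a coderivation that extends a map of letters. -/
def pre (φ : H → H) (m : ℤˣ) (g : Cochain par θ) : Cochain par θ := ⟨fun w => coder par φ m w g⟩

/-- Composition with a coderivation that extends a bracket of letters. -/
def preBr (q : H → H → H) (g : Cochain par θ) : Cochain par θ := ⟨fun w => coderBr par q w g⟩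

theorem pre_add (φ : H → H) (m : ℤˣ) (g h : Cochain par θ) :
    pre φ m (g + h) = pre φ m g + pre φ m h :=
  ext_apply fun w => coder_add par φ m w g h

theorem preBr_add (q : H → H → H) (g h : Cochain par θ) :
    preBr q (g + h) = preBr q g + preBr q h :=
  ext_apply fun w => coderBr_add par q w g h

theorem pre_neg (φ : H → H) (m : ℤˣ) (g : Cochain par θ) : pre φ m (-g) = -pre φ m g :=
  map_neg (AddMonoidHom.mk' (pre (par := par) (θ := θ) φ m) (pre_add φ m)) g

theorem preBr_neg (q : H → H → H) (g : Cochain par θ) : preBr q (-g) = -preBr q g :=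
  map_neg (AddMonoidHom.mk' (preBr (par := par) (θ := θ) q) (preBr_add q)) g

theorem pre_smul (φ : H → H) (m u : ℤˣ) (g : Cochain par θ) : pre φ m (u • g) = u • pre φ m g := by
  rcases Int.units_eq_one_or u with rfl | rfl <;> simp [pre_neg]

theorem preBr_smul (q : H → H → H) (u : ℤˣ) (g : Cochain par θ) :
    preBr q (u • g) = u • preBr q g := by
  rcases Int.units_eq_one_or u with rfl | rfl <;> simp [preBr_neg]

theorem tw_smul (u v : ℤˣ) (g : Cochain par θ) : tw u (v • g) = v • tw u g := by
  refine ext_apply fun w => ?_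
  rw [tw_apply, units_smul_apply, units_smul_apply, tw_apply, map_units_int_smul, smul_comm]

theorem ctr_smul (y : H) (u : ℤˣ) (k : Cochain par θ) : ctr y (u • k) = u • ctr y k :=
  ext_apply fun w => by rw [units_smul_apply, ctr_apply, ctr_apply, units_smul_apply]

theorem ctr_pre (φ : H → H) (m : ℤˣ) (y : H) (g : Cochain par θ) :
    ctr y (pre φ m g) = ctr (φ y) g + koszul m (par y) • pre φ m (ctr y g) :=
  ext_apply fun w => by
    rw [add_apply, units_smul_apply]
    rfl

theorem ctr_preBr (q : H → H → H) (x : H) (g : Cochain par θ) :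
    ctr x (preBr q g) = pre (q x) (-par x) g + par x • preBr q (ctr x g) :=
  ext_apply fun w => by
    rw [add_apply, units_smul_apply]
    rfl

@[simp] theorem pre_nil (φ : H → H) (m : ℤˣ) (g : Cochain par θ) : pre φ m g [] = 0 := rfl
@[simp] theorem preBr_nil (q : H → H → H) (g : Cochain par θ) : preBr q g [] = 0 := rfl

theorem pre_tw {φ : H → H} {m : ℤˣ} (hφ : ∀ y, par (φ y) = m * par y) (v : ℤˣ)
    (g : Cochain par θ) : pre φ m (tw v g) = koszul m v • tw v (pre φ m g) := by
  refine ext_apply fun w => ?_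
  induction w generalizing g with
  | nil => rw [units_smul_apply, tw_apply]; simp
  | cons y w ih =>
    rw [← ctr_apply, ctr_pre, ctr_tw, ctr_tw, pre_smul, add_apply, units_smul_apply,
      units_smul_apply,
      units_smul_apply, ih, ← ctr_apply y (koszul m v • _), ctr_smul, ctr_tw, ctr_pre,
      units_smul_apply,
      units_smul_apply, units_smul_apply, tw_add, add_apply, tw_smul, units_smul_apply, hφ,
      smul_add, smul_add, smul_smul, smul_smul, smul_smul, smul_smul, smul_smul,
      koszul_mul_right, koszul_comm v m]
    congr 2
    ac_rfl

/-- Dual to the coderivation property. By `ctr_pre`, commuting `pre φ m` past `ctr y` produces `ctr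
(φ y)`, again a skew derivation, and `hφ` makes its sign the required one; the rest is the induction
hypothesis. -/
theorem pre_mul {φ : H → H} {m : ℤˣ} (hφ : ∀ y, par (φ y) = m * par y) (g h : Cochain par θ) :
    pre φ m (g * h) = pre φ m g * tw m h + g * pre φ m h := by
  refine ext_apply fun w => ?_
  induction w generalizing g h with
  | nil => rw [add_apply]; simp
  | cons y w ih =>
    rw [← ctr_apply, ← ctr_apply, ctr_add, ctr_pre, ctr_mul, ctr_mul, ctr_mul, ctr_mul, ctr_pre,
      ctr_pre, ctr_tw, pre_add, hφ]
    simp only [add_apply, units_smul_apply, ih, pre_tw hφ, tw_tw, add_mul, mul_add,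
      units_smul_mul, mul_units_smul,
      smul_add, smul_smul, Int.units_mul_self, one_smul, mul_comm (par y) m]
    abel

theorem preBr_tw {q : H → H → H} (hq : ∀ x y, par (q x y) = -par x * par y) (v : ℤˣ)
    (g : Cochain par θ) : preBr q (tw v g) = v • tw v (preBr q g) := by
  refine ext_apply fun w => ?_
  induction w generalizing g with
  | nil => rw [units_smul_apply, tw_apply]; simp
  | cons y w ih =>
    rw [← ctr_apply, ← ctr_apply, ctr_smul, ctr_preBr, ctr_tw, ctr_tw, ctr_preBr, preBr_smul,
      pre_tw (hq y)]
    simp only [tw_add, add_apply, units_smul_apply, ih, tw_smul, smul_add, smul_smul]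
    congr 2
    · rcases Int.units_eq_one_or v with rfl | rfl <;> simp
    · ac_rfl

/-- Same mechanism one level up: commuting `preBr q` past `ctr y` produces `pre (q y)`, whose parity
as an operation on letters is `-par y`, so `pre_mul` applies. -/
theorem preBr_mul {q : H → H → H} (hq : ∀ x y, par (q x y) = -par x * par y)
    (g h : Cochain par θ) : preBr q (g * h) = preBr q g * tw (-1) h + g * preBr q h := by
  refine ext_apply fun w => ?_
  induction w generalizing g h with
  | nil => rw [add_apply]; simp
  | cons y w ih =>
    rw [← ctr_apply, ← ctr_apply, ctr_add, ctr_preBr, ctr_mul, ctr_mul, ctr_mul, ctr_preBr,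
      ctr_preBr, ctr_tw, preBr_add, pre_mul (hq y)]
    simp only [add_apply, units_smul_apply, ih, preBr_tw hq, tw_tw, add_mul, mul_add,
      units_smul_mul,
      mul_units_smul, smul_add, smul_smul, Int.units_mul_self, one_smul, koszul_neg_one_left,
      mul_neg_one, neg_one_mul]
    abel

/-! The differential of the convolution ring. -/

section Differential

variable (d : A →+ A) (q₁ : H → H) (q₂ : H → H → H)

/-- Composition of a cochain with the codifferential that has the components `q₁` and `q₂`. -/
def preQ (g : Cochain par θ) : Cochain par θ := pre q₁ (-1) g + preBr q₂ g

/-- Composition of an additive map with a cochain. -/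
def post (g : Cochain par θ) : Cochain par θ := ⟨fun w => d (g w)⟩

/-- The differential `g ↦ d ∘ g - (-1)^{|g|} g ∘ Q`. -/
def diff (g : Cochain par θ) : Cochain par θ := post d g - preQ q₁ q₂ (tw (-1) g)

theorem preQ_add (g h : Cochain par θ) : preQ q₁ q₂ (g + h) = preQ q₁ q₂ g + preQ q₁ q₂ h := by
  simp only [preQ, pre_add, preBr_add]
  abel

theorem preQ_neg (g : Cochain par θ) : preQ q₁ q₂ (-g) = -preQ q₁ q₂ g := by
  simp only [preQ, pre_neg, preBr_neg, neg_add]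

theorem post_apply (g : Cochain par θ) (w : List H) : post d g w = d (g w) := rfl

theorem diff_add (g h : Cochain par θ) :
    diff d q₁ q₂ (g + h) = diff d q₁ q₂ g + diff d q₁ q₂ h := by
  have e : post d (g + h) = post d g + post d h :=
    ext_apply fun w => map_add d _ _
  simp only [diff, tw_add, preQ_add, e]
  abel

variable {d q₁ q₂}

theorem map_mul_apply (hd : ∀ x y, d (x * y) = d x * y + θ (-1) x * d y)
    (hθ : ∀ u x, d (θ u x) = u • θ u (d x)) (g h : Cochain par θ) :
    post d (g * h) = post d g * h + tw (-1) g * post d h := by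
  refine ext_apply fun w => ?_
  induction w generalizing g h with
  | nil => rw [add_apply]; simp [hd, tw_apply, post_apply]
  | cons x w ih =>
    have e : ∀ k : Cochain par θ, ctr x (post d k) = post d (ctr x k) := fun k => rfl
    have e' : post d (tw (par x) h) = par x • tw (par x) (post d h) := ext_apply fun w => by
      rw [units_smul_apply, post_apply, tw_apply, tw_apply, post_apply, map_units_int_smul, hθ,
        smul_comm]
    change d ((g * h) (x :: w)) = _
    rw [mul_cons, map_add]
    have e1 := ih (ctr x g) (tw (par x) h)
    have e2 := ih g (ctr x h)
    change d _ = _ at e1 e2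
    rw [e1, e2, add_apply (post d g * h), mul_cons, mul_cons, e, e, e', ctr_tw, units_smul_mul,
      mul_units_smul, koszul_neg_one_left]
    simp only [add_apply]
    abel

/-- Composition with the codifferential is an odd derivation whose sign falls on the right factor.
The twist `tw (-1)` in `diff` is an involutive ring automorphism: it cancels that sign on the right
and creates it on the left, in agreement with `post d`. -/
theorem diff_mul (hd : ∀ x y, d (x * y) = d x * y + θ (-1) x * d y)
    (hθ : ∀ u x, d (θ u x) = u • θ u (d x)) (h₁ : ∀ x, par (q₁ x) = -par x)
    (h₂ : ∀ x y, par (q₂ x y) = -par x * par y) (g h : Cochain par θ) :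
    diff d q₁ q₂ (g * h) = diff d q₁ q₂ g * h + tw (-1) g * diff d q₁ q₂ h := by
  have h₁' : ∀ x, par (q₁ x) = -1 * par x := fun x => by rw [h₁, neg_one_mul]
  simp only [diff, map_mul_apply hd hθ, preQ, tw_mul, pre_mul h₁', preBr_mul h₂, sub_mul, mul_sub,
    tw_tw, neg_mul_neg, mul_one, tw_one, add_mul, mul_add]
  abel

theorem diff_const (a : A) (ha : θ (-1) a = a) :
    diff d q₁ q₂ (const a : Cochain par θ) = const (d a) := by
  have e : tw (-1) (const a : Cochain par θ) = const a := ext_apply fun w => by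
    cases w <;> simp [tw_apply, ha]
  have e1 : ∀ φ m, pre φ m (const a : Cochain par θ) = 0 := fun φ m => ext_apply fun w => by
    cases w with
    | nil => rfl
    | cons y w =>
      rw [← ctr_apply, ctr_pre, ctr_const, ctr_const, zero_add]
      have : pre φ m (0 : Cochain par θ) = 0 := by simpa using pre_add φ m (0 : Cochain par θ) 0
      rw [this, smul_zero, zero_apply, zero_apply]
  have e2 : preBr q₂ (const a : Cochain par θ) = 0 := ext_apply fun w => by
    cases w with
    | nil => rfl
    | cons y w =>
      rw [← ctr_apply, ctr_preBr, ctr_const, e1, zero_add]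
      have : preBr q₂ (0 : Cochain par θ) = 0 := by simpa using preBr_add q₂ (0 : Cochain par θ) 0
      rw [this, smul_zero, zero_apply, zero_apply]
  rw [diff, e, preQ, e1, e2, add_zero, sub_zero]
  refine ext_apply fun w => ?_
  cases w <;> simp [post_apply]

end Differential

end Cochain

/-! ### The Chern-Simons transgression

In a graded ring `B` with a degree one derivation `D`, an element `s` of degree one with
`D (D s) = [R, s]` has the curvature `R + D s + s * s`. The difference of the traces of
the powers of the curvature and of `R` is exact. -/

namespace ChernSimons

open Polynomial

variable {B : Type*} [Ring B]

/-- The polynomials whose coefficients belong to an additive subgroup. -/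
def polys (N : AddSubgroup B) : AddSubgroup B[X] where
  carrier := {p | ∀ i, p.coeff i ∈ N}
  add_mem' ha hb i := by simpa using N.add_mem (ha i) (hb i)
  zero_mem' i := by simp [N.zero_mem]
  neg_mem' ha i := by simpa using ha i

theorem C_mem_polys {N : AddSubgroup B} {a : B} (ha : a ∈ N) : C a ∈ polys N := fun i => by
  rw [coeff_C]
  split_ifs
  exacts [ha, N.zero_mem]

theorem C_mul_X_pow_mem_polys {N : AddSubgroup B} {a : B} (ha : a ∈ N) (n : ℕ) :
    C a * X ^ n ∈ polys N := fun i => by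
  rw [coeff_C_mul_X_pow]
  split_ifs
  exacts [ha, N.zero_mem]

variable (G : ℤ → AddSubgroup B)

theorem mul_mem_polys [SetLike.GradedMonoid G] {m n : ℤ} {p q : B[X]} (hp : p ∈ polys (G m))
    (hq : q ∈ polys (G n)) :
    p * q ∈ polys (G (m + n)) := fun i => by
  rw [coeff_mul]
  exact sum_mem fun x _ => SetLike.mul_mem_graded (hp _) (hq _)

theorem pow_mem_polys [SetLike.GradedMonoid G] {m : ℤ} {p : B[X]} (hp : p ∈ polys (G m)) (k : ℕ) :
    p ^ k ∈ polys (G (k * m)) := by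
  induction k with
  | zero => simpa using C_mem_polys (SetLike.GradedOne.one_mem (A := G))
  | succ k ih =>
    have := mul_mem_polys G ih hp
    rw [← pow_succ] at this
    convert this using 2
    push_cast
    ring_nf

/-- The coefficientwise extension of an additive map to polynomials. -/
noncomputable def onCoeffs (D : B →+ B) (p : B[X]) : B[X] := p.sum fun i b => monomial i (D b)

@[simp] theorem coeff_onCoeffs (D : B →+ B) (p : B[X]) (i : ℕ) :
    (onCoeffs D p).coeff i = D (p.coeff i) := by
  simp only [onCoeffs, Polynomial.sum, finsetSum_coeff, coeff_monomial]
  rw [Finset.sum_ite_eq']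
  split_ifs with h
  · rfl
  · rw [notMem_support_iff.1 h, map_zero]

theorem onCoeffs_add (D : B →+ B) (p q : B[X]) :
    onCoeffs D (p + q) = onCoeffs D p + onCoeffs D q := by
  ext i; simp

theorem onCoeffs_C (D : B →+ B) (a : B) : onCoeffs D (C a) = C (D a) := by
  ext i
  rw [coeff_onCoeffs, coeff_C, coeff_C]
  split_ifs <;> simp

theorem onCoeffs_C_mul_X_pow (D : B →+ B) (a : B) (n : ℕ) :
    onCoeffs D (C a * X ^ n) = C (D a) * X ^ n := by
  ext i
  rw [coeff_onCoeffs, coeff_C_mul_X_pow, coeff_C_mul_X_pow]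
  split_ifs <;> simp

theorem coeff_units_smul (u : ℤˣ) (p : B[X]) (i : ℕ) : (u • p).coeff i = u • p.coeff i := by
  rcases Int.units_eq_one_or u with rfl | rfl <;> simp

theorem C_mul_X_mul (a : B) (p : B[X]) : C a * (X * p) = X * (C a * p) := by
  rw [← mul_assoc, ← X_mul_C, mul_assoc]

variable {G} {D : B →+ B}

theorem onCoeffs_mul
    (hD : ∀ {m : ℤ} {a : B}, a ∈ G m → ∀ b, D (a * b) = D a * b + m.negOnePow • (a * D b))
    {m : ℤ} {p : B[X]} (hp : p ∈ polys (G m)) (q : B[X]) :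
    onCoeffs D (p * q) = onCoeffs D p * q + m.negOnePow • (p * onCoeffs D q) := by
  ext i
  simp only [coeff_onCoeffs, coeff_add, coeff_mul, coeff_units_smul, map_sum, Finset.smul_sum,
    ← Finset.sum_add_distrib]
  exact Finset.sum_congr rfl fun x _ => hD (hp _) _

/-! ### Formal integration over `[0, 1]` of traces of polynomials. -/

section Integral

variable {K M : Type*} [Field K] [AddCommGroup M] [Module K M] (τ : B →+ M)

/-- The integral over the unit interval of an additive function of a polynomial. -/
noncomputable def integral (p : B[X]) : M := p.sum fun i b => ((i + 1 : ℕ) : K)⁻¹ • τ b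

theorem integral_eq_sum_range (p : B[X]) (n : ℕ) (hn : p.natDegree < n) :
    integral (K := K) τ p = ∑ i ∈ Finset.range n, ((i + 1 : ℕ) : K)⁻¹ • τ (p.coeff i) :=
  sum_over_range' p (by simp) n hn

theorem integral_congr {p q : B[X]} (h : ∀ i, τ (p.coeff i) = τ (q.coeff i)) :
    integral (K := K) τ p = integral (K := K) τ q := by
  rw [integral_eq_sum_range τ p (p.natDegree + q.natDegree + 1) (by omega),
    integral_eq_sum_range τ q (p.natDegree + q.natDegree + 1) (by omega)]
  simp [h]

theorem integral_add (p q : B[X]) :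
    integral (K := K) τ (p + q) = integral (K := K) τ p + integral (K := K) τ q :=
  sum_add_index p q _ (by simp) (by simp)

theorem integral_neg (p : B[X]) : integral (K := K) τ (-p) = -integral (K := K) τ p :=
  map_neg (AddMonoidHom.mk' (integral (K := K) τ) (integral_add τ)) p

theorem integral_units_smul (u : ℤˣ) (p : B[X]) :
    integral (K := K) τ (u • p) = u • integral (K := K) τ p := by
  rcases Int.units_eq_one_or u with rfl | rfl <;> simp [integral_neg]

theorem integral_mem {N : AddSubgroup B} {P : Submodule K M} (h : ∀ a ∈ N, τ a ∈ P) {p : B[X]}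
    (hp : p ∈ polys N) : integral (K := K) τ p ∈ P :=
  sum_mem fun i _ => P.smul_mem _ (h _ (hp i))

theorem integral_onCoeffs {N : AddSubgroup B} {δ : M →ₗ[K] M} (hδ : ∀ a ∈ N, τ (D a) = δ (τ a))
    {p : B[X]} (hp : p ∈ polys N) :
    integral (K := K) τ (onCoeffs D p) = δ (integral (K := K) τ p) := by
  rw [integral_eq_sum_range τ p ((onCoeffs D p).natDegree + p.natDegree + 1) (by omega),
    integral_eq_sum_range τ _ ((onCoeffs D p).natDegree + p.natDegree + 1) (by omega), map_sum]
  simp [hδ _ (hp _)]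

/-- Fundamental theorem of calculus: the factor `i + 1` of the derivative cancels the weight `1/(i +
1)`, which requires characteristic zero. -/
theorem integral_derivative [CharZero K] (p : B[X]) :
    integral (K := K) τ (derivative p) = τ (p.eval 1) - τ (p.coeff 0) := by
  rw [integral_eq_sum_range τ _ (p.natDegree + 1) (by
      exact Nat.lt_succ_of_le ((natDegree_derivative_le p).trans (Nat.sub_le _ _))),
    eval_eq_sum_range' (n := p.natDegree + 1 + 1) (by omega),
    Finset.sum_range_succ' _ (p.natDegree + 1)]
  simp only [one_pow, mul_one, map_add, map_sum, add_sub_cancel_right]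
  refine Finset.sum_congr rfl fun i _ => ?_
  have e : (p.coeff (i + 1) * ((i : B) + 1)) = (i + 1) • p.coeff (i + 1) := by
    rw [nsmul_eq_mul, Nat.cast_comm, Nat.cast_add, Nat.cast_one]
  rw [coeff_derivative, e, map_nsmul, ← Nat.cast_smul_eq_nsmul K, smul_smul, inv_mul_cancel₀,
    one_smul]
  exact_mod_cast Nat.succ_ne_zero i

variable {τ}

theorem integral_mul_comm
    (hτ : ∀ {m n : ℤ} {a b : B}, a ∈ G m → b ∈ G n → τ (a * b) = (m * n).negOnePow • τ (b * a))
    {m n : ℤ} {p q : B[X]} (hp : p ∈ polys (G m)) (hq : q ∈ polys (G n)) :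
    integral (K := K) τ (p * q) = (m * n).negOnePow • integral (K := K) τ (q * p) := by
  rw [← integral_units_smul]
  refine integral_congr τ fun i => ?_
  rw [coeff_units_smul, map_units_int_smul, coeff_mul, coeff_mul, map_sum, map_sum,
    ← Finset.Nat.sum_antidiagonal_swap, Finset.smul_sum]
  exact Finset.sum_congr rfl fun x _ => hτ (hp _) (hq _)

/-- Without commutativity the power rule holds only under the trace: each summand `F^a F' F^b` can
be cycled to `F' F^{a+b}` without sign, since `F` has even degree. The spare factor `F ^ l` collects
the powers split off during the induction. -/
theorem integral_derivative_pow [SetLike.GradedMonoid G]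
    (hτ : ∀ {m n : ℤ} {a b : B}, a ∈ G m → b ∈ G n → τ (a * b) = (m * n).negOnePow • τ (b * a))
    {F : B[X]} (hF : F ∈ polys (G 2)) (hF' : derivative F ∈ polys (G 2)) (k l : ℕ) :
    integral (K := K) τ (derivative (F ^ (k + 1)) * F ^ l) =
      (k + 1) • integral (K := K) τ (derivative F * F ^ (k + l)) := by
  induction k generalizing l with
  | zero => simp
  | succ k ih =>
    have h := integral_mul_comm (K := K) hτ (pow_mem_polys G hF (k + 1))
      (mul_mem_polys G hF' (pow_mem_polys G hF l))
    rw [Int.negOnePow_even _ ((even_two.mul_left _).mul_right _), one_smul, mul_assoc, ← pow_add,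
      ← mul_assoc] at h
    rw [pow_succ, derivative_mul, add_mul, mul_assoc, ← pow_succ', integral_add, ih, h,
      succ_nsmul _ (k + 1), add_assoc k 1 l, add_comm 1 l, add_comm l (k + 1), add_right_comm k 1 l,
      add_assoc k l 1]

end Integral

/-! ### Bianchi identity and transgression formula. -/

section Transgression

variable {K M : Type*} [Field K] [CharZero K] [AddCommGroup M] [Module K M] {τ : B →+ M}

/-- The curvature of the connection `X * s`. -/
noncomputable def curvature (D : B →+ B) (R s : B) : B[X] :=
  C R + C (D s) * X ^ 1 + C (s * s) * X ^ 2

theorem curvature_mem [SetLike.GradedMonoid G] {R s : B} (hR : R ∈ G 2) (hs : s ∈ G 1)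
    (hDs : D s ∈ G 2) :
    curvature D R s ∈ polys (G 2) :=
  add_mem (add_mem (C_mem_polys hR) (C_mul_X_pow_mem_polys hDs 1))
    (C_mul_X_pow_mem_polys (SetLike.mul_mem_graded hs hs) 2)

/-- Bianchi identity `D F_t = [F_t, t s]`: the terms of degree one and two in `t` come from `D (D
s)` and from the Leibniz rule for `s * s`, and the cubic term vanishes because `s` commutes with `s
* s`. -/
theorem onCoeffs_curvature
    (hD : ∀ {m : ℤ} {a : B}, a ∈ G m → ∀ b, D (a * b) = D a * b + m.negOnePow • (a * D b))
    {R s : B} (hs : s ∈ G 1) (hDR : D R = 0) (hDD : D (D s) = R * s - s * R) :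
    onCoeffs D (curvature D R s) =
      X * (curvature D R s * C s - C s * curvature D R s) := by
  rw [curvature, onCoeffs_add, onCoeffs_add, onCoeffs_C, onCoeffs_C_mul_X_pow,
    onCoeffs_C_mul_X_pow, hDR, hDD, hD hs]
  simp only [Int.negOnePow_one, Units.neg_smul, one_smul, map_zero, zero_add, pow_one, C_add, C_sub,
    C_mul, C_neg, neg_mul, add_mul, mul_add, mul_sub, sub_mul, mul_assoc, ← X_mul_C, C_mul_X_mul,
    pow_two]
  abel

theorem onCoeffs_pow
    (hD : ∀ {m : ℤ} {a : B}, a ∈ G m → ∀ b, D (a * b) = D a * b + m.negOnePow • (a * D b))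
    {s : B} {F : B[X]} (hF : F ∈ polys (G 2)) (h1 : D 1 = 0)
    (h : onCoeffs D F = X * (F * C s - C s * F)) (k : ℕ) :
    onCoeffs D (F ^ k) = X * (F ^ k * C s - C s * F ^ k) := by
  induction k with
  | zero =>
    have := onCoeffs_C D (1 : B)
    rw [h1, map_zero, C_1] at this
    simpa using this
  | succ k ih =>
    rw [pow_succ', onCoeffs_mul hD hF, h, ih, Int.negOnePow_even _ even_two, one_smul,
      ← mul_assoc F X, (commute_X F).eq.symm]
    simp only [mul_sub, sub_mul, mul_assoc]
    abel

/-- The trace of the Chern-Simons form is a primitive of the difference of the traces of the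
powers of the curvature and of `R`. -/
theorem transgression [SetLike.GradedMonoid G]
    (hD : ∀ {m : ℤ} {a : B}, a ∈ G m → ∀ b, D (a * b) = D a * b + m.negOnePow • (a * D b))
    (hτ : ∀ {m n : ℤ} {a b : B}, a ∈ G m → b ∈ G n → τ (a * b) = (m * n).negOnePow • τ (b * a))
    {R s : B} (hR : R ∈ G 2) (hs : s ∈ G 1) (hDs : D s ∈ G 2) (hDR : D R = 0)
    (hDD : D (D s) = R * s - s * R) (k : ℕ) :
    integral (K := K) τ (onCoeffs D (C s * curvature D R s ^ k)) =
      ((k + 1 : ℕ) : K)⁻¹ • (τ ((R + D s + s * s) ^ (k + 1)) - τ (R ^ (k + 1))) := by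
  set F := curvature D R s with hFdef
  have hF : F ∈ polys (G 2) := curvature_mem hR hs hDs
  have hss : s * s ∈ G 2 := SetLike.mul_mem_graded hs hs
  have hF1 : derivative F = C (D s) + (2 : ℕ) • (C (s * s) * X ^ 1) := by
    simp only [hFdef, curvature, derivative_add, derivative_C, derivative_C_mul_X_pow]
    simp [mul_assoc, mul_two, two_mul, add_mul]
  have hF' : derivative F ∈ polys (G 2) := by
    rw [hF1]
    exact add_mem (C_mem_polys hDs) (nsmul_mem (C_mul_X_pow_mem_polys hss 1) 2)
  have h1 : D 1 = 0 := by
    have := hD (SetLike.GradedOne.one_mem (A := G)) 1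
    simpa using this
  -- By Bianchi, `D (s F^k) = (D s) F^k + t s² F^k - t s F^k s`. Cycling the last `s` to the front
  -- moves an odd element past an odd one, so the last term has the trace of `+ t s² F^k`. The sum
  -- is the trace of `(D s + 2 t s²) F^k = F' F^k`.
  have e2 : integral (K := K) τ (onCoeffs D (C s * F ^ k)) =
      integral (K := K) τ (derivative F * F ^ k) := by
    rw [onCoeffs_mul hD (C_mem_polys hs), onCoeffs_C, onCoeffs_pow hD hF h1
      (onCoeffs_curvature hD hs hDR hDD), hF1]
    have e3 := integral_mul_comm (K := K) hτ (mul_mem_polys G (C_mul_X_pow_mem_polys hs 1)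
      (pow_mem_polys G hF k)) (C_mem_polys hs)
    rw [Int.negOnePow_odd _ (by simp [parity_simps])] at e3
    have e4 : C (D s) * F ^ k + Int.negOnePow 1 • (C s * (X * (F ^ k * C s - C s * F ^ k))) =
        C (D s) * F ^ k + C (s * s) * X ^ 1 * F ^ k + -(C s * X ^ 1 * F ^ k * C s) := by
      simp only [Int.negOnePow_one, Units.neg_smul, one_smul, mul_sub, pow_one, C_mul, mul_assoc,
        C_mul_X_mul]
      abel
    rw [e4, integral_add, integral_neg, e3, add_mul, two_nsmul, add_mul, ← add_assoc, integral_add,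
      integral_add, integral_add]
    congr 1
    simp only [Units.neg_smul, one_smul, neg_neg, C_mul, mul_assoc]
  have e5 := integral_derivative_pow (K := K) hτ hF hF' k 0
  rw [pow_zero, mul_one, add_zero, integral_derivative, ← e2] at e5
  have e6 : F.eval 1 = R + D s + s * s := by
    simp [hFdef, curvature]
  have e7 : F.coeff 0 = R := by
    simp [hFdef, curvature]
  -- Over a noncommutative ring evaluation is multiplicative here because the point `1` is central.
  have e8 : (F ^ (k + 1)).eval 1 = F.eval 1 ^ (k + 1) := by
    exact map_pow (eval₂RingHom' (RingHom.id B) 1 fun a => Commute.one_right a) F (k + 1)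
  have e9 : (F ^ (k + 1)).coeff 0 = F.coeff 0 ^ (k + 1) := by
    exact map_pow constantCoeff F (k + 1)
  rw [← e6, ← e7, ← e8, ← e9, e5, ← Nat.cast_smul_eq_nsmul K, smul_smul, inv_mul_cancel₀,
    one_smul]
  exact_mod_cast Nat.succ_ne_zero k

end Transgression

end ChernSimons

/-! ### Forms: cochains on the homogeneous elements of a DG-Lie algebra -/

namespace DGLieAlgebra

variable {K V : Type*} [Field K] [AddCommGroup V] [Module K V] (L : DGLieAlgebra K V)

/-- The homogeneous elements of `L`. -/
abbrev Letter : Type _ := Σ n : ℤ, L.gr n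

variable {L}

/-- The parity of a homogeneous element, as an element of `L[1]`. -/
def par (x : L.Letter) : ℤˣ := (x.1 - 1).negOnePow

theorem par_eq (x : L.Letter) : par x = -x.1.negOnePow := by simp [par, Int.negOnePow_sub]

/-- The degree of a word in `L[1]`. -/
def wordDegree (w : List L.Letter) : ℤ := (w.map fun x => x.1 - 1).sum

@[simp] theorem wordDegree_nil : wordDegree ([] : List L.Letter) = 0 := rfl

@[simp] theorem wordDegree_cons (x : L.Letter) (w : List L.Letter) :
    wordDegree (x :: w) = x.1 - 1 + wordDegree w := by simp [wordDegree]

theorem wordParity_par (w : List L.Letter) : wordParity par w = (wordDegree w).negOnePow := by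
  induction w with
  | nil => simp
  | cons x w ih => rw [wordParity_cons, ih, wordDegree_cons, Int.negOnePow_add, par]

/-- The component `q₁` of the codifferential on homogeneous elements. -/
def letterQ₁ (x : L.Letter) : L.Letter :=
  ⟨x.1 + 1, L.q₁ x.2, Submodule.neg_mem _ (L.d_mem x.2.2)⟩

/-- The component `q₂` of the codifferential on homogeneous elements. -/
def letterQ₂ (x y : L.Letter) : L.Letter :=
  ⟨x.1 + y.1, L.q₂ x.1 x.2 y.2, units_int_smul_mem _ (L.bracket_mem x.2.2 y.2.2)⟩

theorem letterQ₁_val (x : L.Letter) : ((letterQ₁ x).2 : V) = -L.d x.2 := rfl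

theorem par_letterQ₁ (x : L.Letter) : par (letterQ₁ x) = -par x := by
  simp [par, letterQ₁, Int.negOnePow_sub]

theorem par_letterQ₂ (x y : L.Letter) : par (letterQ₂ x y) = -par x * par y := by
  simp [par, letterQ₂, Int.negOnePow_add, Int.negOnePow_sub]

/-- Functions on words of homogeneous elements that come from graded symmetric multilinear maps of
degree `m` on `L[1]`. -/
structure IsForm {M : Type*} [AddCommGroup M] [Module K M] (gr : ℤ → Submodule K M) (m : ℤ)
    (f : List L.Letter → M) : Prop where
  degree : ∀ w, f w ∈ gr (m + wordDegree w)
  symm : ∀ p x y w, f (p ++ x :: y :: w) = koszul (par x) (par y) • f (p ++ y :: x :: w)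
  linear : ∀ p (a : ℤ) (c : K) (x y : L.gr a) w,
    f (p ++ ⟨a, c • x + y⟩ :: w) = c • f (p ++ ⟨a, x⟩ :: w) + f (p ++ ⟨a, y⟩ :: w)

theorem units_int_smul_comm {M : Type*} [AddCommGroup M] [Module K M] (u : ℤˣ) (c : K) (x : M) :
    u • c • x = c • u • x := by
  rcases Int.units_eq_one_or u with rfl | rfl <;> simp

/-- The forms of degree `m`. -/
def forms {M : Type*} [AddCommGroup M] [Module K M] (L : DGLieAlgebra K V)
    (gr : ℤ → Submodule K M) (m : ℤ) : Submodule K (List L.Letter → M) where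
  carrier := {f | IsForm gr m f}
  add_mem' hf hg :=
    { degree := fun w => add_mem (hf.degree w) (hg.degree w)
      symm := fun p x y w => by
        rw [Pi.add_apply, Pi.add_apply, hf.symm, hg.symm, smul_add]
      linear := fun p a c x y w => by
        simp only [Pi.add_apply, hf.linear, hg.linear, smul_add]
        abel }
  zero_mem' :=
    { degree := fun w => zero_mem _
      symm := fun p x y w => by simp
      linear := fun p a c x y w => by simp }
  smul_mem' c f hf :=
    { degree := fun w => Submodule.smul_mem _ c (hf.degree w)
      symm := fun p x y w => by
        rw [Pi.smul_apply, Pi.smul_apply, hf.symm, units_int_smul_comm]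
      linear := fun p a c x y w => by
        simp only [Pi.smul_apply, hf.linear, smul_add]
        rw [smul_comm] }

theorem IsForm.map {M N : Type*} [AddCommGroup M] [Module K M] [AddCommGroup N] [Module K N]
    {gr : ℤ → Submodule K M} {gr' : ℤ → Submodule K N} {m : ℤ} {f : List L.Letter → M}
    (hf : IsForm gr m f) (T : M →ₗ[K] N) (hT : ∀ n, ∀ x ∈ gr n, T x ∈ gr' n) :
    IsForm gr' m fun w => T (f w) where
  degree w := hT _ _ (hf.degree w)
  symm p x y w := by rw [hf.symm, map_units_int_smul]
  linear p a c x y w := by rw [hf.linear, map_add, map_smul]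

theorem IsForm.contract {M : Type*} [AddCommGroup M] [Module K M] {gr : ℤ → Submodule K M} {m : ℤ}
    {f : List L.Letter → M} (hf : IsForm gr m f) (x : L.Letter) :
    IsForm gr (m + (x.1 - 1)) (contract x f) where
  degree w := by
    have := hf.degree (x :: w)
    rwa [wordDegree_cons, ← add_assoc] at this
  symm p y z w := hf.symm (x :: p) y z w
  linear p a c y z w := hf.linear (x :: p) a c y z w

end DGLieAlgebra

namespace CurvedDGAlgebra

variable {K A : Type*} [Field K] [Ring A] [Algebra K A] (𝒜 : CurvedDGAlgebra K A)

variable {𝒜} in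
theorem hom_ext {M : Type*} [AddCommGroup M] {f g : A →+ M}
    (h : ∀ (i : ℤ), ∀ x ∈ 𝒜.gr i, f x = g x) : f = g := by
  classical
  ext x
  rw [← DirectSum.sum_support_decompose 𝒜.gr x, map_sum, map_sum]
  exact Finset.sum_congr rfl fun i _ => h i _ (SetLike.coe_mem _)

theorem signTwist_mul (i : ℤ) (x y : A) :
    𝒜.signTwist i (x * y) = 𝒜.signTwist i x * 𝒜.signTwist i y := by
  have h : ∀ j, ∀ x ∈ 𝒜.gr j,
      ((𝒜.signTwist i).toAddMonoidHom.comp (AddMonoidHom.mulLeft x)) =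
        (AddMonoidHom.mulLeft (𝒜.signTwist i x)).comp (𝒜.signTwist i).toAddMonoidHom := by
    refine fun j x hx => hom_ext (𝒜 := 𝒜) fun l y hy => ?_
    change 𝒜.signTwist i (x * y) = 𝒜.signTwist i x * 𝒜.signTwist i y
    rw [signTwist_apply i (SetLike.mul_mem_graded hx hy), signTwist_apply i hx,
      signTwist_apply i hy, units_int_smul_mul, mul_units_int_smul, smul_smul, mul_add,
      Int.negOnePow_add]
  have h' : ((𝒜.signTwist i).toAddMonoidHom.comp (AddMonoidHom.mulRight y)) =
      (AddMonoidHom.mulRight (𝒜.signTwist i y)).comp (𝒜.signTwist i).toAddMonoidHom :=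
    hom_ext (𝒜 := 𝒜) fun j x hx => DFunLike.congr_fun (h j x hx) y
  exact DFunLike.congr_fun h' x

/-- The parity operator of `A`. -/
noncomputable def parity : A →+* A where
  toFun := 𝒜.signTwist 1
  map_one' := by
    rw [signTwist_apply 1 (SetLike.GradedOne.one_mem (A := 𝒜.gr))]
    simp
  map_mul' := 𝒜.signTwist_mul 1
  map_zero' := map_zero _
  map_add' := map_add _

variable {𝒜} in
theorem parity_apply {n : ℤ} {x : A} (hx : x ∈ 𝒜.gr n) : 𝒜.parity x = n.negOnePow • x := by
  change 𝒜.signTwist 1 x = _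
  rw [signTwist_apply 1 hx, one_mul]

theorem parity_parity (x : A) : 𝒜.parity (𝒜.parity x) = x := by
  have : 𝒜.parity.toAddMonoidHom.comp 𝒜.parity.toAddMonoidHom = AddMonoidHom.id A :=
    hom_ext (𝒜 := 𝒜) fun i x hx => by
      change 𝒜.parity (𝒜.parity x) = x
      rw [parity_apply hx, map_units_int_smul, parity_apply hx, smul_smul, Int.units_mul_self,
        one_smul]
  exact DFunLike.congr_fun this x

/-- The action of signs on `A` through the parity operator. -/
noncomputable def signAction : ℤˣ →* (A →+* A) where
  toFun u := if u = -1 then 𝒜.parity else 1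
  map_one' := rfl
  map_mul' u v := by
    have h : 𝒜.parity * 𝒜.parity = 1 := RingHom.ext 𝒜.parity_parity
    rcases Int.units_eq_one_or u with rfl | rfl <;>
    rcases Int.units_eq_one_or v with rfl | rfl <;> simp [h]

variable {𝒜}

theorem signAction_apply (u : ℤˣ) {n : ℤ} {x : A} (hx : x ∈ 𝒜.gr n) :
    𝒜.signAction u x = koszul u n.negOnePow • x := by
  rcases Int.units_eq_one_or u with rfl | rfl
  · simp
  · rw [koszul_neg_one_left, ← parity_apply hx]
    rfl

theorem signAction_smul (u : ℤˣ) (c : K) (x : A) :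
    𝒜.signAction u (c • x) = c • 𝒜.signAction u x := by
  rcases Int.units_eq_one_or u with rfl | rfl
  · simp
  · exact map_smul (𝒜.signTwist 1) c x

theorem d_mul_parity (x y : A) : 𝒜.d (x * y) = 𝒜.d x * y + 𝒜.signAction (-1) x * 𝒜.d y := by
  have h : 𝒜.d.toAddMonoidHom.comp (AddMonoidHom.mulRight y) =
      (AddMonoidHom.mulRight y).comp 𝒜.d.toAddMonoidHom +
      (AddMonoidHom.mulRight (𝒜.d y)).comp (𝒜.signAction (-1)).toAddMonoidHom :=
    hom_ext (𝒜 := 𝒜) fun i x hx => by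
      change 𝒜.d (x * y) = 𝒜.d x * y + 𝒜.signAction (-1) x * 𝒜.d y
      rw [signAction_apply _ hx, 𝒜.d_mul hx, koszul_neg_one_left, units_int_smul_mul]
  exact DFunLike.congr_fun h x

theorem d_signAction (u : ℤˣ) (x : A) :
    𝒜.d (𝒜.signAction u x) = u • 𝒜.signAction u (𝒜.d x) := by
  rcases Int.units_eq_one_or u with rfl | rfl
  · simp
  have h : 𝒜.d.toAddMonoidHom.comp (𝒜.signAction (-1)).toAddMonoidHom =
      -((𝒜.signAction (-1)).toAddMonoidHom.comp 𝒜.d.toAddMonoidHom) :=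
    hom_ext (𝒜 := 𝒜) fun i x hx => by
      change 𝒜.d (𝒜.signAction (-1) x) = -𝒜.signAction (-1) (𝒜.d x)
      rw [signAction_apply _ hx, signAction_apply _ (𝒜.d_mem hx), map_units_int_smul,
        koszul_neg_one_left, koszul_neg_one_left, Int.negOnePow_succ, Units.neg_smul, neg_neg]
  rw [Units.neg_smul, one_smul]
  exact DFunLike.congr_fun h x

end CurvedDGAlgebra

/-! ### The graded ring of forms with values in a curved DG-algebra -/

namespace CurvedDGAlgebra

open DGLieAlgebra Cochain

variable {K V A : Type*} [Field K] [AddCommGroup V] [Module K V] [Ring A] [Algebra K A]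
  (L : DGLieAlgebra K V) (𝒜 : CurvedDGAlgebra K A)

/-- Cochains on homogeneous elements of `L` with values in `A`. -/
abbrev Cochains : Type _ := Cochain (par : L.Letter → ℤˣ) 𝒜.signAction

/-- The cochains that are forms of degree `m`. -/
def formCochains (m : ℤ) : AddSubgroup (𝒜.Cochains L) where
  carrier := {g | IsForm 𝒜.gr m g}
  add_mem' hf hg := (forms L 𝒜.gr m).add_mem hf hg
  zero_mem' := (forms L 𝒜.gr m).zero_mem
  neg_mem' hf := (forms L 𝒜.gr m).neg_mem hf

variable {L 𝒜}

theorem ctr_mem {m : ℤ} {g : 𝒜.Cochains L} (hg : g ∈ 𝒜.formCochains L m) (x : L.Letter) :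
    ctr x g ∈ 𝒜.formCochains L (m + (x.1 - 1)) :=
  IsForm.contract hg x

/-- The value on `w` has degree `m + |w|`, so the sign from the word and the sign from the value
combine to one that depends on `m` only. Thus `tw`, defined on all cochains without a grading, is
the usual Koszul sign on forms. -/
theorem tw_eq_smul (u : ℤˣ) {m : ℤ} {g : 𝒜.Cochains L} (hg : g ∈ 𝒜.formCochains L m) :
    tw u g = koszul u m.negOnePow • g := by
  refine ext_apply fun w => ?_
  rw [tw_apply, units_smul_apply, signAction_apply u (hg.degree w), smul_smul, wordParity_par,
    Int.negOnePow_add, koszul_mul_right, mul_comm, mul_assoc, Int.units_mul_self, mul_one]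

theorem tw_mem (u : ℤˣ) {m : ℤ} {g : 𝒜.Cochains L} (hg : g ∈ 𝒜.formCochains L m) :
    tw u g ∈ 𝒜.formCochains L m := by
  rw [tw_eq_smul u hg]
  exact units_int_smul_mem _ hg

theorem mul_degree {m n : ℤ} {g h : 𝒜.Cochains L} (hg : g ∈ 𝒜.formCochains L m)
    (hh : h ∈ 𝒜.formCochains L n) (w : List L.Letter) :
    (g * h) w ∈ 𝒜.gr (m + n + wordDegree w) := by
  induction w generalizing g h m n with
  | nil =>
    have h1 := hg.degree []
    have h2 := hh.degree []
    rw [wordDegree_nil, add_zero] at *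
    exact SetLike.mul_mem_graded h1 h2
  | cons x w ih =>
    have h1 := ih (ctr_mem hg x) (tw_mem (par x) hh)
    have h2 := ih hg (ctr_mem hh x)
    rw [mul_cons, wordDegree_cons]
    refine add_mem ?_ ?_
    · convert h1 using 2
      ring
    · convert h2 using 2
      ring

/-- For the first two letters, contracting twice gives four terms. Those with both letters in the
same factor use the symmetry of that factor; the two mixed terms are exchanged. -/
theorem mul_symm {m n : ℤ} {g h : 𝒜.Cochains L} (hg : g ∈ 𝒜.formCochains L m)
    (hh : h ∈ 𝒜.formCochains L n) (p : List L.Letter) (x y : L.Letter) (w : List L.Letter) :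
    (g * h) (p ++ x :: y :: w) = koszul (par x) (par y) • (g * h) (p ++ y :: x :: w) := by
  induction p generalizing g h m n with
  | nil =>
    have e : ∀ {k : ℤ} {f : 𝒜.Cochains L}, f ∈ 𝒜.formCochains L k →
        ctr y (ctr x f) = koszul (par x) (par y) • ctr x (ctr y f) := fun hf =>
      ext_apply fun w => by
        rw [units_smul_apply]
        exact hf.symm [] x y w
    have h0 : koszul (par x) (par y) * koszul (par x) (par y) = 1 := Int.units_mul_self _
    simp only [List.nil_append, ← ctr_apply, ctr_mul, ctr_tw, e hg, e hh, tw_tw,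
      Cochain.add_apply, mul_units_smul, units_smul_mul, units_smul_apply, smul_add,
      koszul_comm (par y) (par x),
      smul_smul, h0, one_smul, mul_comm (par y) (par x)]
    abel
  | cons z p ih =>
    rw [List.cons_append, List.cons_append, mul_cons, mul_cons, smul_add,
      ih (ctr_mem hg z) (tw_mem (par z) hh), ih hg (ctr_mem hh z)]

theorem mul_linear {m n : ℤ} {g h : 𝒜.Cochains L} (hg : g ∈ 𝒜.formCochains L m)
    (hh : h ∈ 𝒜.formCochains L n) (p : List L.Letter) (a : ℤ) (c : K) (x y : L.gr a)
    (w : List L.Letter) :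
    (g * h) (p ++ ⟨a, c • x + y⟩ :: w) =
      c • (g * h) (p ++ ⟨a, x⟩ :: w) + (g * h) (p ++ ⟨a, y⟩ :: w) := by
  induction p generalizing g h m n with
  | nil =>
    have e : ∀ {k : ℤ} {f : 𝒜.Cochains L}, f ∈ 𝒜.formCochains L k →
        contract (⟨a, c • x + y⟩ : L.Letter) f =
          c • contract (⟨a, x⟩ : L.Letter) f + contract (⟨a, y⟩ : L.Letter) f := fun hf =>
      funext fun w => hf.linear [] a c x y w
    change conv _ _ _ _ _ + conv _ _ _ _ _ =
      c • (conv _ _ _ _ _ + conv _ _ _ _ _) + (conv _ _ _ _ _ + conv _ _ _ _ _)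
    rw [e hg, e hh, conv_add_left, conv_add_right, conv_smul_left,
      conv_smul_right _ _ signAction_smul, smul_add]
    have hp : ∀ z : L.gr a, par (⟨a, z⟩ : L.Letter) = (a - 1).negOnePow := fun _ => rfl
    simp only [hp]
    abel
  | cons z p ih =>
    rw [List.cons_append, List.cons_append, List.cons_append, mul_cons, mul_cons, mul_cons,
      ih (ctr_mem hg z) (tw_mem (par z) hh), ih hg (ctr_mem hh z), smul_add]
    abel

instance : SetLike.GradedMonoid (𝒜.formCochains L) where
  one_mem :=
    { degree := fun w => by
        cases w with
        | nil => simpa using SetLike.GradedOne.one_mem (A := 𝒜.gr)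
        | cons x w => exact zero_mem _
      symm := fun p x y w => by
        cases p <;> simp [one_cons]
      linear := fun p a c x y w => by
        cases p <;> simp [one_cons] }
  mul_mem _ _ _ _ hg hh :=
    { degree := mul_degree hg hh
      symm := mul_symm hg hh
      linear := mul_linear hg hh }

/-- The unshuffle coproduct is graded cocommutative, so cyclicity passes from `A` to cochains: the
two terms produced by the first letter trade places. Only the degrees of the forms enter, not their
symmetry. -/
theorem trace_mul_comm {C : Type*} [AddCommGroup C] (τ : A →+ C)
    (hτ : ∀ {i j : ℤ} {x y : A}, x ∈ 𝒜.gr i → y ∈ 𝒜.gr j →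
      τ (x * y) = (i * j).negOnePow • τ (y * x))
    {m n : ℤ} {g h : 𝒜.Cochains L} (hg : g ∈ 𝒜.formCochains L m)
    (hh : h ∈ 𝒜.formCochains L n) (w : List L.Letter) :
    τ ((g * h) w) = (m * n).negOnePow • τ ((h * g) w) := by
  induction w generalizing g h m n with
  | nil =>
    have h1 := hτ (hg.degree []) (hh.degree [])
    rwa [wordDegree_nil, add_zero, add_zero] at h1
  | cons x w ih =>
    rw [mul_cons, mul_cons, map_add, map_add, tw_eq_smul _ hh, tw_eq_smul _ hg, mul_units_smul,
      mul_units_smul, units_smul_apply, units_smul_apply, map_units_int_smul, map_units_int_smul,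
      ih (ctr_mem hg x) hh, ih hg (ctr_mem hh x), smul_add, smul_smul, smul_smul, par,
      koszul_negOnePow, koszul_negOnePow, ← Int.negOnePow_add, ← Int.negOnePow_add, add_comm]
    congr 2
    · rw [Int.negOnePow_eq_iff]
      exact ⟨0, by ring⟩
    · rw [Int.negOnePow_eq_iff]
      exact ⟨(x.1 - 1) * n, by ring⟩

end CurvedDGAlgebra

/-! ### The connection cochain of a degree zero linear map `L → A` and its curvature -/

namespace CurvedDGAlgebra

open DGLieAlgebra Cochain

variable {K V A : Type*} [Field K] [AddCommGroup V] [Module K V] [Ring A] [Algebra K A]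
  {L : DGLieAlgebra K V} {𝒜 : CurvedDGAlgebra K A}

variable (L 𝒜) in
/-- A linear map `L → A`, as a cochain. -/
def connection (S : V →ₗ[K] A) : 𝒜.Cochains L where
  toFun
    | [x] => S x.2
    | _ => 0

/-- The cochain with components the failure of `S` to commute with the differentials, and `S` of
the bracket. -/
def connectionDiff (S : V →ₗ[K] A) : 𝒜.Cochains L where
  toFun
    | [x] => 𝒜.d (S x.2) - S (L.d x.2)
    | [x, y] => S (L.q₂ x.1 x.2 y.2)
    | _ => 0

variable (L 𝒜) in
/-- The differential on cochains. -/
noncomputable def cochainDiff : 𝒜.Cochains L →+ 𝒜.Cochains L :=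
  AddMonoidHom.mk' (diff (𝒜.d : A →+ A) letterQ₁ letterQ₂) (diff_add _ _ _)

theorem cochainDiff_mul {m : ℤ} {g : 𝒜.Cochains L} (hg : g ∈ 𝒜.formCochains L m)
    (h : 𝒜.Cochains L) :
    cochainDiff L 𝒜 (g * h) =
      cochainDiff L 𝒜 g * h + m.negOnePow • (g * cochainDiff L 𝒜 h) := by
  change diff _ _ _ _ = diff _ _ _ _ * _ + _ • (_ * diff _ _ _ _)
  rw [diff_mul d_mul_parity d_signAction par_letterQ₁ par_letterQ₂, tw_eq_smul _ hg,
    units_smul_mul, koszul_neg_one_left]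

theorem cochainDiff_apply {m : ℤ} {g : 𝒜.Cochains L} (hg : g ∈ 𝒜.formCochains L m)
    (w : List L.Letter) :
    cochainDiff L 𝒜 g w = 𝒜.d (g w) - m.negOnePow • preQ letterQ₁ letterQ₂ g w := by
  change (post _ g - preQ _ _ _ : 𝒜.Cochains L) w = _
  rw [tw_eq_smul _ hg, koszul_neg_one_left, Cochain.sub_apply, ← units_smul_apply]
  rcases Int.units_eq_one_or m.negOnePow with e | e <;> simp [e, preQ_neg, post_apply]

theorem signAction_of_even (u : ℤˣ) {x : A} (hx : x ∈ 𝒜.gr 2) : 𝒜.signAction u x = x := by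
  rw [signAction_apply u hx, Int.negOnePow_even _ even_two, koszul_one_right, one_smul]

theorem const_mem {x : A} (hx : x ∈ 𝒜.gr 2) : (const x : 𝒜.Cochains L) ∈ 𝒜.formCochains L 2 where
  degree w := by
    cases w with
    | nil => simpa using hx
    | cons x w => exact zero_mem _
  symm p x y w := by cases p <;> simp
  linear p a c x y w := by cases p <;> simp

theorem const_mul_apply (a : A) (g : 𝒜.Cochains L) (w : List L.Letter) :
    (const a * g : 𝒜.Cochains L) w = a * g w := by
  induction w generalizing g with
  | nil => rfl
  | cons x w ih => rw [mul_cons, ctr_const, zero_mul, Cochain.zero_apply, zero_add, ih, ctr_apply]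

theorem tw_const (u : ℤˣ) (a : A) : tw u (const a : 𝒜.Cochains L) = const (𝒜.signAction u a) :=
  ext_apply fun w => by cases w <;> simp [tw_apply]

theorem mul_const_apply (a : A) (g : 𝒜.Cochains L) (w : List L.Letter) :
    (g * const a : 𝒜.Cochains L) w = g w * 𝒜.signAction (wordParity par w) a := by
  induction w generalizing g a with
  | nil => simp
  | cons x w ih =>
    rw [mul_cons, ctr_const, mul_zero, Cochain.zero_apply, add_zero, tw_const, ih, ctr_apply,
      wordParity_cons, mul_comm (par x), map_mul]
    rfl

theorem connection_mem {S : V →ₗ[K] A} (hS : ∀ n, ∀ x ∈ L.gr n, S x ∈ 𝒜.gr n) :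
    connection L 𝒜 S ∈ 𝒜.formCochains L 1 where
  degree w := by
    match w with
    | [] => exact zero_mem _
    | [x] =>
      have := hS _ _ x.2.2
      change S x.2 ∈ _
      convert this using 2
      simp
    | _ :: _ :: _ => exact zero_mem _
  symm p x y w := by
    match p with
    | [] | [_] | _ :: _ :: _ => simp [connection]
  linear p a c x y w := by
    match p, w with
    | [], [] => simp [connection]
    | [], _ :: _ | [_], [] | [_], _ :: _ | _ :: _ :: _, _ => simp [connection]

theorem connectionDiff_mem {S : V →ₗ[K] A} (hS : ∀ n, ∀ x ∈ L.gr n, S x ∈ 𝒜.gr n) :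
    (connectionDiff S : 𝒜.Cochains L) ∈ 𝒜.formCochains L 2 where
  degree w := by
    match w with
    | [] => exact zero_mem _
    | [x] =>
      have h1 := 𝒜.d_mem (hS _ _ x.2.2)
      have h2 := hS _ _ (L.d_mem x.2.2)
      change 𝒜.d (S x.2) - S (L.d x.2) ∈ _
      convert sub_mem h1 h2 using 2
      simp only [wordDegree_cons, wordDegree_nil]
      ring
    | [x, y] =>
      have h1 := hS _ _ (letterQ₂ x y).2.2
      change S (letterQ₂ x y).2 ∈ _
      convert h1 using 2
      simp only [wordDegree_cons, wordDegree_nil, letterQ₂]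
      ring
    | _ :: _ :: _ :: _ => exact zero_mem _
  symm p x y w := by
    match p, w with
    | [], [] =>
      change S (L.q₂ x.1 x.2 y.2) = _ • S (L.q₂ y.1 y.2 x.2)
      rw [← map_units_int_smul]
      congr 1
      rw [DGLieAlgebra.q₂, DGLieAlgebra.q₂, L.antisymm x.2.2 y.2.2, smul_neg, smul_smul, smul_smul,
        ← Units.neg_smul, par, par, koszul_negOnePow, ← Int.negOnePow_add, ← Int.negOnePow_add,
        ← Int.negOnePow_succ]
      congr 1
      rw [Int.negOnePow_eq_iff]
      exact ⟨x.1, by ring⟩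
    | [], _ :: _ | [_], [] | [_], _ :: _ | _ :: _ :: _, _ => simp [connectionDiff]
  linear p a c x y w := by
    match p, w with
    | [], [] =>
      simp only [connectionDiff, List.nil_append, Submodule.coe_add, Submodule.coe_smul, map_add,
        map_smul, smul_sub]
      abel
    | [], [z] =>
      simp only [connectionDiff, List.nil_append, Submodule.coe_add, Submodule.coe_smul, q₂,
        map_add, map_smul, LinearMap.add_apply, LinearMap.smul_apply, smul_add,
        map_units_int_smul]
      congr 1
      exact units_int_smul_comm (M := A) _ c _
    | [z], [] =>
      simp only [connectionDiff, List.cons_append, List.nil_append, Submodule.coe_add,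
        Submodule.coe_smul, q₂, map_add, map_smul, smul_add, map_units_int_smul]
      congr 1
      exact units_int_smul_comm (M := A) _ c _
    | [], _ :: _ :: _ | [_], _ :: _ | _ :: _ :: _, _ => simp [connectionDiff]

/-- Since `s` has odd degree, its differential is `d ∘ s + s ∘ Q`; the codifferential shortens a
word by at most one letter, so nothing survives beyond length two. -/
theorem cochainDiff_connection {S : V →ₗ[K] A} (hS : ∀ n, ∀ x ∈ L.gr n, S x ∈ 𝒜.gr n) :
    cochainDiff L 𝒜 (connection L 𝒜 S) = connectionDiff S := by
  refine ext_apply fun w => ?_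
  rw [cochainDiff_apply (connection_mem hS), Int.negOnePow_one, Units.neg_smul, one_smul,
    sub_neg_eq_add]
  change 𝒜.d _ + (coder par letterQ₁ (-1) w _ + coderBr par letterQ₂ w _) = _
  match w with
  | [] => simp [coder, coderBr, connection, connectionDiff]
  | [x] => simp [coder, coderBr, connection, connectionDiff, letterQ₁_val, sub_eq_add_neg]
  | [x, y] => simp [coder, coderBr, contract, connection, connectionDiff, letterQ₂]
  | x :: y :: z :: w =>
    rw [coder_eq_zero, coderBr_eq_zero]
    · simp [connection, connectionDiff]
    · intro v hv
      match v, hv with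
      | _ :: _ :: _, _ => rfl
    · intro v hv
      match v, hv with
      | _ :: _ :: _, _ => rfl

/-- Checked by word length: length one is `d² = [R, -]` in `A` together with `d² = 0` in `L`, length
two is the Leibniz rule of `L`, length three is its Jacobi identity. This replaces a general proof
of `D² = [R, -]`, since the transgression applies `D` twice only to the connection. -/
theorem cochainDiff_connectionDiff {S : V →ₗ[K] A} (hS : ∀ n, ∀ x ∈ L.gr n, S x ∈ 𝒜.gr n) :
    cochainDiff L 𝒜 (connectionDiff S) =
      const 𝒜.R * connection L 𝒜 S - connection L 𝒜 S * const 𝒜.R := by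
  refine ext_apply fun w => ?_
  rw [cochainDiff_apply (connectionDiff_mem hS), Int.negOnePow_even _ even_two, one_smul,
    Cochain.sub_apply, const_mul_apply, mul_const_apply, signAction_of_even _ 𝒜.R_mem]
  change 𝒜.d _ - (coder par letterQ₁ (-1) w _ + coderBr par letterQ₂ w _) = _
  match w with
  | [] => simp [coder, coderBr, connection, connectionDiff]
  | [x] =>
    simp [coder, coderBr, connection, connectionDiff, letterQ₁_val, 𝒜.d_d, L.d_d]
  | [x, y] =>
    simp only [coder, coderBr, contract, connection, connectionDiff, letterQ₂, letterQ₁, q₂, q₁]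
    have h := L.leibniz x.2.2 y.2.2
    rw [par_eq x, Int.negOnePow_succ]
    rcases Int.units_eq_one_or x.1.negOnePow with e | e <;> simp [e, h] <;> abel
  | [x, y, z] =>
    have h := L.jacobi x.2.2 y.2.2 z.2.2
    simp only [coder, coderBr, contract, connection, connectionDiff, letterQ₂, letterQ₁, q₂, q₁]
    have hk : koszul x.1.negOnePow (-y.1.negOnePow) =
        x.1.negOnePow * (x.1 * y.1).negOnePow := by
      rw [← neg_one_mul, koszul_mul_right, koszul_neg_one_right, koszul_negOnePow]
    rw [par_eq x, par_eq y, neg_neg, hk, Int.negOnePow_add]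
    rcases Int.units_eq_one_or x.1.negOnePow with e | e <;>
    rcases Int.units_eq_one_or y.1.negOnePow with e' | e' <;>
    rcases Int.units_eq_one_or (x.1 * y.1).negOnePow with e'' | e'' <;>
    simp [e, e', e'', h] <;> abel
  | x :: y :: z :: t :: w =>
    rw [coder_eq_zero, coderBr_eq_zero]
    · simp [connection, connectionDiff]
    · intro v hv
      match v, hv with
      | _ :: _ :: _ :: _, _ => rfl
    · intro v hv
      match v, hv with
      | _ :: _ :: _ :: _, _ => rfl

theorem connection_mul_connection_cons {S : V →ₗ[K] A} (hS : ∀ n, ∀ x ∈ L.gr n, S x ∈ 𝒜.gr n)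
    (x : L.Letter) (w : List L.Letter) :
    (connection L 𝒜 S * connection L 𝒜 S : 𝒜.Cochains L) (x :: w) =
      par x • (S x.2 * connection L 𝒜 S w) +
        koszul (wordParity par w) x.1.negOnePow • (connection L 𝒜 S w * S x.2) := by
  have e : ctr x (connection L 𝒜 S) = const (S x.2 : A) := ext_apply fun w => by
    cases w <;> rfl
  rw [mul_cons, e, tw_eq_smul _ (connection_mem hS), mul_units_smul, units_smul_apply,
    const_mul_apply, mul_const_apply, signAction_apply _ (hS _ _ x.2.2), mul_units_int_smul,
    Int.negOnePow_one, koszul_neg_one_right]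

/-- Stability of `P` under signs is needed because convolution twists the right factor. -/
theorem mul_apply_mem {N P : Submodule K A} (hP : ∀ u, ∀ x ∈ P, 𝒜.signAction u x ∈ P)
    {g h : 𝒜.Cochains L} (hg : ∀ w, g w ∈ N) (hh : ∀ w, h w ∈ P) (w : List L.Letter) :
    (g * h : 𝒜.Cochains L) w ∈ N * P := by
  induction w generalizing g h with
  | nil => exact Submodule.mul_mem_mul (hg []) (hh [])
  | cons x w ih =>
    rw [mul_cons]
    refine add_mem (ih (fun w => hg (x :: w)) fun w => ?_) (ih hg fun w => hh (x :: w))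
    rw [tw_apply]
    exact units_int_smul_mem _ (hP _ _ (hh w))

theorem pow_apply_mem {P : Submodule K A} (hP : ∀ u, ∀ x ∈ P, 𝒜.signAction u x ∈ P)
    {g : 𝒜.Cochains L} (hg : ∀ w, g w ∈ P) (k : ℕ) (w : List L.Letter) :
    (g ^ k : 𝒜.Cochains L) w ∈ P ^ k := by
  induction k generalizing w with
  | zero =>
    rw [pow_zero, pow_zero]
    cases w with
    | nil => exact Submodule.one_le.1 le_rfl
    | cons x w => exact zero_mem _
  | succ k ih =>
    rw [pow_succ, pow_succ]
    exact mul_apply_mem hP ih hg w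

theorem signAction_mem (I : CurvedLieIdeal 𝒜) (u : ℤˣ) : ∀ x ∈ I.carrier,
    𝒜.signAction u x ∈ I.carrier := by
  rcases Int.units_eq_one_or u with rfl | rfl
  · simp
  have h : I.carrier ≤ I.carrier.comap (𝒜.signTwist 1) :=
    induction_homogeneous I.homogeneous fun i x hx hI => by
      rw [Submodule.mem_comap, signTwist_apply 1 hx]
      exact units_int_smul_mem _ hI
  exact h

/-- By word length, the curvature is `R`, then `d S - S d`, then `(-1)^{|x|} (S [x, y] - [S x, S
y])`, then zero. So its values measure how far `S` is from a morphism, and `S` is one modulo `I`. -/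
theorem curvature_apply_mem (I : CurvedLieIdeal 𝒜) {S : V →ₗ[K] A}
    (hS : ∀ n, ∀ x ∈ L.gr n, S x ∈ 𝒜.gr n) (hd : ∀ x, 𝒜.d (S x) - S (L.d x) ∈ I.carrier)
    (hb : ∀ x y, S (L.bracket x y) - 𝒜.comm (S x) (S y) ∈ I.carrier) (w : List L.Letter) :
    (const 𝒜.R + connectionDiff S + connection L 𝒜 S * connection L 𝒜 S : 𝒜.Cochains L) w ∈
      I.carrier := by
  rw [Cochain.add_apply, Cochain.add_apply]
  match w with
  | [] =>
    rw [mul_nil]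
    simpa [connection, connectionDiff] using I.R_mem
  | [x] =>
    rw [connection_mul_connection_cons hS]
    simpa [connection, connectionDiff] using hd x.2
  | [x, y] =>
    rw [connection_mul_connection_cons hS]
    have h := hb x.2 y.2
    rw [comm_apply (hS _ _ x.2.2) (hS _ _ y.2.2)] at h
    have e : koszul (wordParity par [y]) x.1.negOnePow =
        x.1.negOnePow * (x.1 * y.1).negOnePow := by
      rw [wordParity_cons, wordParity_nil, mul_one, par_eq, ← neg_one_mul, koszul_mul_left,
        koszul_neg_one_left, koszul_negOnePow, mul_comm y.1]
    convert units_int_smul_mem x.1.negOnePow h using 1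
    simp only [connection, connectionDiff, const_cons, q₂, e, par_eq, map_units_int_smul]
    rcases Int.units_eq_one_or x.1.negOnePow with e | e <;>
    rcases Int.units_eq_one_or (x.1 * y.1).negOnePow with e' | e' <;>
    simp [e, e'] <;> abel
  | x :: y :: z :: w =>
    rw [connection_mul_connection_cons hS]
    simp [connection, connectionDiff]

end CurvedDGAlgebra

/-! ### Permutations of words, and unshuffles -/

section Permutations

/-- The permutation of `Fin (n + 1)` that sends `0` to `p` and follows `σ` on the other indices. -/
def permCons {n : ℕ} (p : Fin (n + 1)) (σ : Equiv.Perm (Fin n)) : Equiv.Perm (Fin (n + 1)) :=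
  ((finSuccEquiv' 0).trans (Equiv.optionCongr σ)).trans (finSuccEquiv' p).symm

@[simp] theorem permCons_zero {n : ℕ} (p : Fin (n + 1)) (σ : Equiv.Perm (Fin n)) :
    permCons p σ 0 = p := by
  simp [permCons]

@[simp] theorem permCons_succ {n : ℕ} (p : Fin (n + 1)) (σ : Equiv.Perm (Fin n)) (i : Fin n) :
    permCons p σ i.succ = p.succAbove (σ i) := by
  have : finSuccEquiv' 0 i.succ = some i := by
    rw [← Fin.zero_succAbove, finSuccEquiv'_succAbove]
  simp [permCons, this]

theorem permCons_bijective (n : ℕ) :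
    Function.Bijective fun x : Fin (n + 1) × Equiv.Perm (Fin n) => permCons x.1 x.2 := by
  rw [Fintype.bijective_iff_injective_and_card]
  refine ⟨fun ⟨p, σ⟩ ⟨q, τ⟩ h => ?_, ?_⟩
  · have h0 : p = q := by simpa using DFunLike.congr_fun h 0
    subst h0
    congr 1
    ext1 i
    have hi : p.succAbove (σ i) = p.succAbove (τ i) := by
      simpa using DFunLike.congr_fun h i.succ
    exact Fin.succAbove_right_injective hi
  · simp [Fintype.card_perm, Nat.factorial_succ]

/-- The inversions that involve position `0` are the pairs formed by `p` and the smaller indices;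
all others are inversions of `σ`. -/
theorem koszulSign_permCons {n : ℕ} (b : Fin (n + 1) → ℤ) (p : Fin (n + 1))
    (σ : Equiv.Perm (Fin n)) :
    koszulSign b (permCons p σ) =
      (∏ k, if k < p then (b p * b k).negOnePow else 1) *
        koszulSign (fun i => b (p.succAbove i)) σ := by
  rw [koszulSign, Fin.prod_univ_succ, koszulSign]
  congr 1
  · rw [← Equiv.prod_comp (permCons p σ) fun k => if k < p then (b p * b k).negOnePow else 1]
    refine Finset.prod_congr rfl fun j _ => ?_
    refine Fin.cases ?_ (fun j => ?_) j <;> simp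
  · refine Finset.prod_congr rfl fun i _ => ?_
    rw [Fin.prod_univ_succ]
    simp [(Fin.strictMono_succAbove p).lt_iff_lt]

@[simp] theorem koszulSign_one {n : ℕ} (b : Fin n → ℤ) : koszulSign b 1 = 1 := by
  refine Finset.prod_eq_one fun i _ => Finset.prod_eq_one fun j _ => ?_
  rw [if_neg]
  rintro ⟨h1, h2⟩
  exact lt_asymm h1 h2

/-- The second value is `p.succAbove q`, which exceeds `p` exactly when `p ≤ q.castSucc`. The
remaining values increase, and the only increasing permutation is the identity. -/
theorem isUnshuffle_two_permCons {m : ℕ} (p : Fin (m + 2)) (q : Fin (m + 1))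
    (τ : Equiv.Perm (Fin m)) :
    IsUnshuffle 2 (permCons p (permCons q τ)) ↔ p ≤ q.castSucc ∧ τ = 1 := by
  constructor
  · intro h
    constructor
    · have := h 0 1 (by simp) (Or.inl (by simp))
      rw [permCons_zero, ← Fin.succ_zero_eq_one, permCons_succ, permCons_zero] at this
      exact Fin.lt_succAbove_iff_le_castSucc _ _ |>.1 this
    · have hτ : StrictMono τ := fun i j hij => by
        have := h i.succ.succ j.succ.succ (by simpa using hij) (Or.inr (by simp))
        rw [permCons_succ, permCons_succ, permCons_succ, permCons_succ,
          (Fin.strictMono_succAbove _).lt_iff_lt, (Fin.strictMono_succAbove _).lt_iff_lt] at this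
        exact this
      exact Equiv.ext fun _ => hτ.apply_eq
  · rintro ⟨h, rfl⟩ i j hij hc
    induction i using Fin.cases with
    | zero =>
      induction j using Fin.cases with
      | zero => exact absurd hij (lt_irrefl _)
      | succ j =>
        have hj : j = 0 := by
          rcases hc with hc | hc
          · ext
            simp at hc ⊢
            omega
          · simp at hc
        subst hj
        rw [permCons_zero, permCons_succ, permCons_zero]
        exact (Fin.lt_succAbove_iff_le_castSucc _ _).2 h
    | succ i =>
      induction j using Fin.cases with
      | zero => exact absurd hij (by simp)
      | succ j =>
        induction i using Fin.cases with
        | zero =>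
          exfalso
          rcases hc with hc | hc
          · have h1 : 1 < j.val + 1 := hij
            have h2 : j.val + 1 < 2 := hc
            omega
          · simp at hc
        | succ i =>
          induction j using Fin.cases with
          | zero => exact absurd hij (by simp)
          | succ j =>
            rw [permCons_succ, permCons_succ, permCons_succ, permCons_succ,
              (Fin.strictMono_succAbove _).lt_iff_lt, (Fin.strictMono_succAbove _).lt_iff_lt]
            simpa using hij

theorem sum_isUnshuffle_two {M : Type*} [AddCommMonoid M] {m : ℕ}
    (F : Equiv.Perm (Fin (m + 2)) → M) :
    ∑ σ ∈ Finset.univ.filter (fun σ : Equiv.Perm (Fin (m + 2)) => IsUnshuffle 2 σ), F σ =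
      ∑ p : Fin (m + 2), ∑ q : Fin (m + 1),
        if p ≤ q.castSucc then F (permCons p (permCons q 1)) else 0 := by
  rw [Finset.sum_filter, ← (permCons_bijective _).sum_comp, Fintype.sum_prod_type]
  refine Finset.sum_congr rfl fun p _ => ?_
  rw [← (permCons_bijective _).sum_comp, Fintype.sum_prod_type]
  refine Finset.sum_congr rfl fun q _ => ?_
  simp only [isUnshuffle_two_permCons]
  rw [Finset.sum_eq_single 1]
  · simp
  · intro τ _ hτ
    rw [if_neg fun h => hτ h.2]
  · simp

end Permutations

/-! ### Graded symmetric functions on words: reordering letters, closed formulas for coderivations.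
-/

section SymmetricCochains

variable {H M : Type*} [AddCommGroup M] (par : H → ℤˣ)

/-- Graded symmetry of a function on words. -/
def IsGradedSymm (f : List H → M) : Prop :=
  ∀ p x y w, f (p ++ x :: y :: w) = koszul (par x) (par y) • f (p ++ y :: x :: w)

/-- The sign of moving the letter at `p` to the front of a word. -/
def frontSign {n : ℕ} (X : Fin n → H) (p : Fin n) : ℤˣ :=
  ∏ k, if k < p then koszul (par (X p)) (par (X k)) else 1

@[simp] theorem frontSign_zero {n : ℕ} (X : Fin (n + 1) → H) : frontSign par X 0 = 1 :=
  Finset.prod_eq_one fun k _ => by simp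

theorem frontSign_succ {n : ℕ} (X : Fin (n + 1) → H) (p : Fin n) :
    frontSign par X p.succ =
      koszul (par (X p.succ)) (par (X 0)) * frontSign par (fun i => X i.succ) p := by
  simp [frontSign, Fin.prod_univ_succ]

variable {par} {f : List H → M}

theorem IsGradedSymm.swap (hf : IsGradedSymm par f) (x y : H) (w : List H) :
    f (x :: y :: w) = koszul (par x) (par y) • f (y :: x :: w) := hf [] x y w

theorem IsGradedSymm.contract (hf : IsGradedSymm par f) (x : H) :
    IsGradedSymm par (contract x f) := fun p y z w => hf (x :: p) y z w

theorem ofFn_succAbove_succ {n : ℕ} (X : Fin (n + 2) → H) (p : Fin (n + 1)) :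
    List.ofFn (fun i => X (p.succ.succAbove i)) =
      X 0 :: List.ofFn fun i => X (p.succAbove i).succ := by
  rw [List.ofFn_succ]
  simp

theorem IsGradedSymm.apply_ofFn (hf : IsGradedSymm par f) {n : ℕ} (X : Fin (n + 1) → H)
    (p : Fin (n + 1)) :
    f (List.ofFn X) = frontSign par X p • f (X p :: List.ofFn fun i => X (p.succAbove i)) := by
  induction n generalizing f with
  | zero =>
    obtain rfl : p = 0 := Fin.fin_one_eq_zero p
    simp
  | succ n ih =>
    induction p using Fin.cases with
    | zero => simp [List.ofFn_succ]
    | succ p =>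
      have h := ih (hf.contract (X 0)) (fun i => X i.succ) p
      rw [contract_apply, contract_apply] at h
      rw [List.ofFn_succ, h, hf.swap, ofFn_succAbove_succ, frontSign_succ, smul_smul,
        koszul_comm (par (X 0)), mul_comm]

/-- Adjacent transpositions suffice: the letter that `σ` puts first is moved to the front by
adjacent swaps, and the rest is a shorter permutation of the contracted function. -/
theorem IsGradedSymm.apply_perm (hf : IsGradedSymm par f) {n : ℕ} (X : Fin n → H)
    {b : Fin n → ℤ} (hb : ∀ i, par (X i) = (b i).negOnePow) (σ : Equiv.Perm (Fin n)) :
    f (List.ofFn fun i => X (σ i)) = koszulSign b σ • f (List.ofFn X) := by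
  induction n generalizing f with
  | zero => simp [koszulSign]
  | succ n ih =>
    obtain ⟨⟨p, τ⟩, rfl⟩ := (permCons_bijective n).2 σ
    have h := ih (hf.contract (X p)) (fun i => X (p.succAbove i)) (fun i => hb _) τ
    rw [contract_apply, contract_apply] at h
    have e : frontSign par X p = ∏ k, if k < p then (b p * b k).negOnePow else 1 := by
      simp only [frontSign, hb, koszul_negOnePow]
    simp only [List.ofFn_succ (f := fun i => X (permCons p τ i)), permCons_zero, permCons_succ]
    rw [h, hf.apply_ofFn X p, koszulSign_permCons, ← e, smul_smul, mul_right_comm,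
      Int.units_mul_self, one_mul]

theorem coder_ofFn (φ : H → H) (m : ℤˣ) {n : ℕ} (X : Fin n → H) (f : List H → M) :
    coder par φ m (List.ofFn X) f =
      ∑ j, (∏ k, if k < j then koszul m (par (X k)) else 1) •
        f (List.ofFn (Function.update X j (φ (X j)))) := by
  induction n generalizing f with
  | zero => simp [coder]
  | succ n ih =>
    induction X using Fin.consCases with
    | cons x X =>
    rw [List.ofFn_cons, coder, ih, Fin.sum_univ_succ, Finset.smul_sum]
    congr 1
    · simp [Fin.update_cons_zero]
    · refine Finset.sum_congr rfl fun j _ => ?_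
      rw [Fin.prod_univ_succ, Fin.cons_succ, ← Fin.cons_update, List.ofFn_cons, smul_smul]
      simp [contract_apply]

theorem IsGradedSymm.coder_ofFn (hf : IsGradedSymm par f) {φ : H → H} {m : ℤˣ}
    (hφ : ∀ y, par (φ y) = m * par y) {n : ℕ} (X : Fin (n + 1) → H) :
    coder par φ m (List.ofFn X) f =
      ∑ j, frontSign par X j • f (φ (X j) :: List.ofFn fun i => X (j.succAbove i)) := by
  rw [_root_.coder_ofFn]
  refine Finset.sum_congr rfl fun j _ => ?_
  rw [hf.apply_ofFn _ j, smul_smul, frontSign, frontSign, ← Finset.prod_mul_distrib]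
  congr 1
  · refine Finset.prod_congr rfl fun k _ => ?_
    split_ifs with h
    · rw [Function.update_self, Function.update_of_ne h.ne, hφ, koszul_mul_left, ← mul_assoc,
        Int.units_mul_self, one_mul]
    · simp
  · simp

/-- The recursion for `coderBr` becomes the double sum that indexes `(2, n-2)`-unshuffles: brackets
with the first letter give `i = 0`, and the tail gives the other `i`. Symmetry brings each bracketed
letter to the front. -/
theorem IsGradedSymm.coderBr_ofFn (hf : IsGradedSymm par f) {q : H → H → H}
    (hq : ∀ x y, par (q x y) = -par x * par y) {m : ℕ} (X : Fin (m + 2) → H) :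
    coderBr par q (List.ofFn X) f =
      ∑ i : Fin (m + 2), ∑ j : Fin (m + 1), if i ≤ j.castSucc then
        (frontSign par X i * frontSign par (fun k => X (i.succAbove k)) j) •
          f (q (X i) (X (i.succAbove j)) :: List.ofFn fun k => X (i.succAbove (j.succAbove k)))
        else 0 := by
  induction m generalizing f with
  | zero => simp [coderBr, coder]
  | succ m ih =>
    have hq' : ∀ y, par (q (X 0) y) = -par (X 0) * par y := hq _
    rw [List.ofFn_succ, coderBr, hf.coder_ofFn hq', ih (hf.contract (X 0)),
      Fin.sum_univ_succ (n := m + 2),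
      Finset.smul_sum]
    congr 1
    · simp
    · refine Finset.sum_congr rfl fun i _ => ?_
      rw [Finset.smul_sum, Fin.sum_univ_succ (n := m + 1), if_neg (by simp), zero_add]
      refine Finset.sum_congr rfl fun j _ => ?_
      by_cases h : i ≤ j.castSucc
      · rw [if_pos h, if_pos (by simpa using h), contract_apply, hf.swap, frontSign_succ,
          frontSign_succ, ofFn_succAbove_succ (fun k => X (i.succ.succAbove k)) j, hq, neg_mul,
          ← neg_one_mul, koszul_mul_right, koszul_mul_right, koszul_neg_one_right]
        simp only [Fin.succ_succAbove_succ, Fin.succ_succAbove_zero, smul_smul]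
        congr 1
        rw [koszul_comm (par (X 0)), koszul_comm (par (X 0))]
        rcases Int.units_eq_one_or (par (X 0)) with e | e <;> simp [e] <;> ac_rfl
      · rw [if_neg h, if_neg (by simpa using h), smul_zero]

end SymmetricCochains

/-! ### `L∞` morphisms to complexes from closed forms -/

namespace DGLieAlgebra

variable {K V W : Type*} [Field K] [AddCommGroup V] [Module K V] [AddCommGroup W] [Module K W]
  {L : DGLieAlgebra K V}

theorem ofFn_update {H : Type*} {n : ℕ} [DecidableEq (Fin n)] (X : Fin n → H) (i : Fin n) (y : H) :
    List.ofFn (Function.update X i y) =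
      (List.ofFn X).take i ++ y :: (List.ofFn X).drop (i + 1) := by
  have h : List.ofFn (Function.update X i y) = (List.ofFn X).set i y := by
    refine List.ext_getElem (by simp) fun j h1 h2 => ?_
    rw [List.getElem_set, List.getElem_ofFn, List.getElem_ofFn, Function.update_apply]
    simp only [Fin.ext_iff, eq_comm]
  rw [h, List.set_eq_take_append_cons_drop, if_pos (by simp)]

namespace IsForm

variable {gr : ℤ → Submodule K W} {m : ℤ} {f : List L.Letter → W}

theorem apply_zero (hf : IsForm gr m f) (p : List L.Letter) (a : ℤ) (w : List L.Letter) :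
    f (p ++ ⟨a, 0⟩ :: w) = 0 := by
  have h := hf.linear p a 1 0 0 w
  rw [smul_zero, add_zero, one_smul] at h
  exact left_eq_add.1 h

/-- The restriction of a form to words with prescribed degrees, as a multilinear map. -/
def multilinear (hf : IsForm gr m f) {n : ℕ} (a : Fin n → ℤ) :
    MultilinearMap K (fun i => L.gr (a i)) W where
  toFun x := f (List.ofFn fun i => (⟨a i, x i⟩ : L.Letter))
  map_update_add' {dec} x i y z := by
    have e : ∀ v, (fun j => (⟨a j, Function.update x i v j⟩ : L.Letter)) =
        Function.update (fun j => (⟨a j, x j⟩ : L.Letter)) i ⟨a i, v⟩ := fun v => by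
      ext1 j
      by_cases h : j = i
      · subst h
        simp
      · simp [h]
    have h := hf.linear ((List.ofFn fun j => (⟨a j, x j⟩ : L.Letter)).take i) (a i) 1 y z
      ((List.ofFn fun j => (⟨a j, x j⟩ : L.Letter)).drop (i + 1))
    simpa only [e, ofFn_update, one_smul] using h
  map_update_smul' {dec} x i c y := by
    have e : ∀ v, (fun j => (⟨a j, Function.update x i v j⟩ : L.Letter)) =
        Function.update (fun j => (⟨a j, x j⟩ : L.Letter)) i ⟨a i, v⟩ := fun v => by
      ext1 j
      by_cases h : j = i
      · subst h
        simp
      · simp [h]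
    have h := hf.linear ((List.ofFn fun j => (⟨a j, x j⟩ : L.Letter)).take i) (a i) c y 0
      ((List.ofFn fun j => (⟨a j, x j⟩ : L.Letter)).drop (i + 1))
    simpa only [e, ofFn_update, hf.apply_zero, add_zero] using h

/-- The multilinear maps on `L` that correspond to a form. -/
noncomputable def coeff (hf : IsForm gr m f) (n : ℕ) : MultilinearMap K (fun _ : Fin n => V) W :=
  (MultilinearMap.fromDirectSumEquiv (R := K) (κ := fun _ : Fin n => ℤ) (M := fun _ j => L.gr j)
    fun a => hf.multilinear a).compLinearMap
      fun _ => (DirectSum.decomposeLinearEquiv L.gr).toLinearMap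

theorem coeff_apply (hf : IsForm gr m f) {n : ℕ} (X : Fin n → L.Letter) :
    hf.coeff n (fun i => (X i).2) = f (List.ofFn X) := by
  have h := MultilinearMap.fromDirectSumEquiv_lof (R := K) (κ := fun _ : Fin n => ℤ)
    (M := fun _ j => L.gr j) (fun a => hf.multilinear a) (fun i => (X i).1) (fun i => (X i).2)
  rw [coeff, MultilinearMap.compLinearMap_apply]
  simp only [LinearEquiv.coe_coe, DirectSum.decomposeLinearEquiv_apply_coe]
  exact h

theorem isGradedSymm (hf : IsForm gr m f) : IsGradedSymm par f := hf.symm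

end IsForm

theorem negOnePow_sum {ι : Type*} (s : Finset ι) (a : ι → ℤ) :
    (∑ j ∈ s, a j).negOnePow = ∏ j ∈ s, (a j).negOnePow := by
  classical
  induction s using Finset.induction_on with
  | empty => simp
  | insert i s hi ih => rw [Finset.sum_insert hi, Finset.prod_insert hi, Int.negOnePow_add, ih]

theorem wordDegree_ofFn {n : ℕ} (X : Fin n → L.Letter) :
    wordDegree (List.ofFn X) = ∑ i, ((X i).1 - 1) := by
  rw [wordDegree, List.map_ofFn, List.sum_ofFn]
  rfl

/-- A form of degree one on `L` with values in a complex, that vanishes on the empty word and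
satisfies the structure equation, is an `L∞` morphism to the complex. -/
noncomputable def IsForm.toLInfinityMorphism [CharZero K] {D : DGSpace K W}
    {f : List L.Letter → W} (hf : IsForm D.gr 1 f) (h0 : f [] = 0)
    (hd : ∀ w, -D.d (f w) = coder par letterQ₁ (-1) w f + coderBr par letterQ₂ w f) :
    LInfinityMorphism L D.abelian where
  coeff := hf.coeff
  coeff_zero := by
    ext x
    have h := hf.coeff_apply (n := 0) (fun i => i.elim0)
    rw [List.ofFn_zero, h0] at h
    exact (congrArg _ (Subsingleton.elim _ _)).trans h
  coeff_mem n a x hx := by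
    have h := hf.degree (List.ofFn fun i => (⟨a i, x i, hx i⟩ : L.Letter))
    rw [← hf.coeff_apply, wordDegree_ofFn, add_comm] at h
    exact h
  coeff_symm n a x hx σ := by
    have h := hf.isGradedSymm.apply_perm (fun i => (⟨a i, x i, hx i⟩ : L.Letter))
      (b := fun i => a i - 1) (fun i => rfl) σ
    rw [← hf.coeff_apply, ← hf.coeff_apply] at h
    exact h
  compat n a x hx := by
    set X : Fin n → L.Letter := fun i => ⟨a i, x i, hx i⟩ with hX
    have h := hd (List.ofFn X)
    have e0 : D.abelian.q₂Comp hf.coeff n a x = 0 := by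
      simp [q₂Comp, q₂, DGSpace.abelian]
    have e1 : L.compQ₀ (hf.coeff n) a x = coder par letterQ₁ (-1) (List.ofFn X) f := by
      rw [coder_ofFn, compQ₀]
      refine Finset.sum_congr rfl fun i _ => ?_
      rw [← hf.coeff_apply, negOnePow_sum, Finset.prod_filter]
      congr 2
      ext1 j
      by_cases h : j = i
      · subst h
        rw [Function.update_self, Function.update_self]
        rfl
      · rw [Function.update_of_ne h, Function.update_of_ne h]
    have e2 : L.compQ₁ hf.coeff n a x = coderBr par letterQ₂ (List.ofFn X) f := by
      match n, a, x, hx, X, hX with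
      | 0, a, x, hx, X, hX => rfl
      | 1, a, x, hx, X, hX => simp [compQ₁, coderBr, coder]
      | m + 2, a, x, hx, X, hX =>
        rw [compQ₁, sum_isUnshuffle_two, hf.isGradedSymm.coderBr_ofFn par_letterQ₂]
        refine Finset.sum_congr rfl fun i _ => Finset.sum_congr rfl fun j _ => ?_
        congr 1
        rw [koszulSign_permCons, koszulSign_permCons, koszulSign_one, mul_one]
        have e3 : ∀ {k : ℕ} (Y : Fin k → L.Letter) (p : Fin k), frontSign par Y p =
            ∏ l, if l < p then (((Y p).1 - 1) * ((Y l).1 - 1)).negOnePow else 1 := fun Y p => by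
          simp only [frontSign, par, koszul_negOnePow]
        rw [e3, e3, ← List.ofFn_cons, ← hf.coeff_apply]
        subst hX
        refine congrArg₂ (· • ·) rfl (congrArg _ (funext fun l => ?_))
        refine Fin.cases ?_ (fun l => ?_) l
        · simp only [Fin.cons_zero, permCons_zero, ← Fin.succ_zero_eq_one, permCons_succ]
          rfl
        · simp only [Fin.cons_succ, permCons_succ, Equiv.Perm.one_apply]
          rfl
    rw [e0, e1, e2, add_zero, ← h, ← hf.coeff_apply]
    rfl

theorem IsForm.toLInfinityMorphism_coeff [CharZero K] {D : DGSpace K W}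
    {f : List L.Letter → W} (hf : IsForm D.gr 1 f) (h0 : f [] = 0)
    (hd : ∀ w, -D.d (f w) = coder par letterQ₁ (-1) w f + coderBr par letterQ₂ w f) (x : L.Letter) :
    (hf.toLInfinityMorphism h0 hd).coeff 1 (fun _ => x.2) = f [x] := by
  have h := hf.coeff_apply (n := 1) (fun _ => x)
  exact h.trans (by simp)

end DGLieAlgebra

/-! ### The Chern-Simons form of a trace map -/

namespace CurvedLieIdeal

variable {K A : Type*} [Field K] [Ring A] [Algebra K A] {𝒜 : CurvedDGAlgebra K A}
  (I : CurvedLieIdeal 𝒜)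

/-- Each degree splits because the coefficients form a field; the splittings are glued along the
grading of the quotient. Compatibility with differentials or brackets is not asked for: its failure
is the curvature. -/
theorem exists_graded_section : ∃ S : (A ⧸ I.carrier) →ₗ[K] A,
    (∀ n, ∀ x ∈ I.quotient.gr n, S x ∈ 𝒜.gr n) ∧ ∀ x, I.carrier.mkQ (S x) = x := by
  have hσ : ∀ n, ∃ σ : I.quotient.gr n →ₗ[K] 𝒜.gr n,
      I.carrier.mkQ.submoduleMap (𝒜.gr n) ∘ₗ σ = LinearMap.id := fun n =>
    LinearMap.exists_rightInverse_of_surjective _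
      (LinearMap.range_eq_top.2 (LinearMap.submoduleMap_surjective _ _))
  choose σ hσ using hσ
  let S : (A ⧸ I.carrier) →ₗ[K] A :=
    DirectSum.toModule K ℤ A (fun n => (𝒜.gr n).subtype ∘ₗ σ n) ∘ₗ
      (DirectSum.decomposeLinearEquiv I.quotient.gr).toLinearMap
  have hS : ∀ n (x : I.quotient.gr n), S x = σ n x := fun n x => by
    simp only [S, LinearMap.comp_apply, LinearEquiv.coe_coe,
      DirectSum.decomposeLinearEquiv_apply_coe, DirectSum.toModule_lof]
    rfl
  refine ⟨S, fun n x hx => ?_, fun x => ?_⟩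
  · have := hS n ⟨x, hx⟩
    rw [this]
    exact (σ n _).2
  · classical
    rw [← DirectSum.sum_support_decompose I.quotient.gr x, map_sum, map_sum]
    refine Finset.sum_congr rfl fun n _ => ?_
    rw [hS]
    exact congrArg Subtype.val (LinearMap.congr_fun (hσ n) _)

end CurvedLieIdeal

namespace TraceMap

open DGLieAlgebra CurvedDGAlgebra Cochain Polynomial ChernSimons

variable {K A C V : Type*} [Field K] [Ring A] [Algebra K A] [AddCommGroup C]
  [Module K C] [AddCommGroup V] [Module K V] {𝒜 : CurvedDGAlgebra K A} {𝒞 : DGSpace K C}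
  (Tr : TraceMap 𝒜 𝒞)

theorem map_mul_comm {i j : ℤ} {x y : A} (hx : x ∈ 𝒜.gr i) (hy : y ∈ 𝒜.gr j) :
    Tr.toLin (x * y) = (i * j).negOnePow • Tr.toLin (y * x) := by
  have h := Tr.map_comm (𝒜.comm x y) (Submodule.subset_span ⟨x, y, rfl⟩)
  rwa [CurvedDGAlgebra.comm_apply hx hy, map_sub, map_units_int_smul, sub_eq_zero] at h

variable (I : CurvedLieIdeal 𝒜) (k : ℕ) (L : DGLieAlgebra K V)

/-- The trace, modulo the image of `I^{(k+1)} A`. -/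
def quotientTrace : A →ₗ[K] C ⧸ Tr.image I (k + 1) := (Tr.image I (k + 1)).mkQ ∘ₗ Tr.toLin

/-- The trace on cochains, modulo the image of `I^{(k+1)} A`. -/
noncomputable def cochainTrace : 𝒜.Cochains L →+ (List L.Letter → C ⧸ Tr.image I (k + 1)) :=
  AddMonoidHom.mk' (fun g w => Tr.quotientTrace I k (g w)) fun g h => funext fun w =>
    map_add (Tr.quotientTrace I k) (g w) (h w)

theorem quotientTrace_eq_zero {x : A} (hx : x ∈ I.carrier ^ (k + 1)) :
    Tr.quotientTrace I k x = 0 := by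
  refine (Submodule.Quotient.mk_eq_zero _).2 (Submodule.mem_map_of_mem ?_)
  rw [← mul_one x]
  exact Submodule.mul_mem_mul hx Submodule.mem_top

/-- The differential of cochains of odd degree with values in the quotient complex. -/
noncomputable def oddDiff : (List L.Letter → C ⧸ Tr.image I (k + 1)) →ₗ[K]
    (List L.Letter → C ⧸ Tr.image I (k + 1)) where
  toFun f w := (Tr.quotient I k).d (f w) +
    (coder par letterQ₁ (-1) w f + coderBr par letterQ₂ w f)
  map_add' f g := funext fun w => by
    simp only [Pi.add_apply, map_add, coder_add, coderBr_add]
    abel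
  map_smul' c f := funext fun w => by
    have e1 := coder_map par (letterQ₁ (L := L)) (-1)
      (DistribSMul.toAddMonoidHom (C ⧸ Tr.image I (k + 1)) c) w f
    have e2 := coderBr_map par (letterQ₂ (L := L))
      (DistribSMul.toAddMonoidHom (C ⧸ Tr.image I (k + 1)) c) w f
    simp only [DistribSMul.toAddMonoidHom_apply] at e1 e2
    change (Tr.quotient I k).d (c • f w) + (coder par letterQ₁ (-1) w (fun v => c • f v) +
      coderBr par letterQ₂ w fun v => c • f v) = c • (_ + (_ + _))
    rw [e1, e2, map_smul, smul_add, smul_add]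

variable {L}

/-- Oddness of `m` fixes the sign of the codifferential term, so that a single linear map `oddDiff`
serves for all coefficients of the Chern-Simons polynomial. -/
theorem cochainTrace_cochainDiff {m : ℤ} (hm : Odd m) {g : 𝒜.Cochains L}
    (hg : g ∈ 𝒜.formCochains L m) :
    Tr.cochainTrace I k L (cochainDiff L 𝒜 g) = Tr.oddDiff I k L (Tr.cochainTrace I k L g) := by
  ext1 w
  change Tr.quotientTrace I k (cochainDiff L 𝒜 g w) = (Tr.quotient I k).d (Tr.quotientTrace I k _) +
    (coder par letterQ₁ (-1) w (fun v => (Tr.quotientTrace I k).toAddMonoidHom (g v)) +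
      coderBr par letterQ₂ w fun v => (Tr.quotientTrace I k).toAddMonoidHom (g v))
  rw [coder_map, coderBr_map, cochainDiff_apply hg, Int.negOnePow_odd _ hm, Units.neg_smul,
    one_smul,
    sub_neg_eq_add, map_add]
  refine congrArg₂ (· + ·) ?_ (map_add (Tr.quotientTrace I k) _ _)
  change (Tr.image I (k + 1)).mkQ _ = (Tr.image I (k + 1)).mkQ (𝒞.d _)
  rw [Tr.map_d]

theorem cochainTrace_mem {m : ℤ} {g : 𝒜.Cochains L} (hg : g ∈ 𝒜.formCochains L m) :
    Tr.cochainTrace I k L g ∈ forms L (Tr.quotient I k).gr m :=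
  IsForm.map hg (Tr.quotientTrace I k) fun _ x hx => ⟨Tr.toLin x, Tr.map_mem hx, rfl⟩

/-- The Chern-Simons form of a linear map `S : L → A`. -/
noncomputable def chernSimons (S : V →ₗ[K] A) : List L.Letter → C ⧸ Tr.image I (k + 1) :=
  (Nat.factorial k : K)⁻¹ • integral (K := K) (Tr.cochainTrace I k L)
    (Polynomial.C (connection L 𝒜 S) *
      curvature (cochainDiff L 𝒜) (const 𝒜.R) (connection L 𝒜 S) ^ k)

variable {S : V →ₗ[K] A}

theorem chernSimons_polynomial_mem (hS : ∀ n, ∀ x ∈ L.gr n, S x ∈ 𝒜.gr n) :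
    Polynomial.C (connection L 𝒜 S) *
      curvature (cochainDiff L 𝒜) (const 𝒜.R) (connection L 𝒜 S) ^ k ∈
        polys (𝒜.formCochains L (1 + k * 2)) := by
  refine mul_mem_polys _ (C_mem_polys (connection_mem hS)) (pow_mem_polys _ ?_ k)
  refine curvature_mem (const_mem 𝒜.R_mem) (connection_mem hS) ?_
  rw [cochainDiff_connection hS]
  exact connectionDiff_mem hS

theorem chernSimons_isForm (hS : ∀ n, ∀ x ∈ L.gr n, S x ∈ 𝒜.gr n) :
    IsForm (L := L) (Tr.quotient I k).gr (1 + k * 2) (Tr.chernSimons I k S) :=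
  (forms L (Tr.quotient I k).gr (1 + k * 2)).smul_mem _
    (integral_mem _ (fun _ ha => Tr.cochainTrace_mem I k ha) (chernSimons_polynomial_mem k hS))

theorem oddDiff_chernSimons [CharZero K] (hS : ∀ n, ∀ x ∈ L.gr n, S x ∈ 𝒜.gr n)
    (hd : ∀ x, 𝒜.d (S x) - S (L.d x) ∈ I.carrier)
    (hb : ∀ x y, S (L.bracket x y) - 𝒜.comm (S x) (S y) ∈ I.carrier) :
    Tr.oddDiff I k L (Tr.chernSimons I k S) = 0 := by
  have hDs := cochainDiff_connection (L := L) hS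
  have hodd : Odd (1 + (k : ℤ) * 2) := ⟨k, by ring⟩
  have h := transgression (K := K) (G := 𝒜.formCochains L) (D := cochainDiff L 𝒜)
    (τ := Tr.cochainTrace I k L) (fun ha b => cochainDiff_mul ha b)
    (fun {m n a b} ha hb => by
      rw [← map_units_int_smul]
      ext1 w
      have := trace_mul_comm (Tr.quotientTrace I k).toAddMonoidHom
        (fun hx hy => by
          change (Tr.image I (k + 1)).mkQ _ = _ • (Tr.image I (k + 1)).mkQ _
          rw [Tr.map_mul_comm hx hy, map_units_int_smul]) ha hb w
      rw [← map_units_int_smul, ← units_smul_apply] at this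
      exact this)
    (const_mem 𝒜.R_mem) (connection_mem hS) (by rw [hDs]; exact connectionDiff_mem hS)
    (by
      change diff _ _ _ _ = _
      rw [diff_const _ (signAction_of_even _ 𝒜.R_mem)]
      refine ext_apply fun w => ?_
      cases w
      · exact 𝒜.d_R
      · rfl)
    (by rw [hDs]; exact cochainDiff_connectionDiff hS) k
  -- This applies at both ends of the path: to the curvature of `s` and to the constant cochain `R`.
  have hz : ∀ g : 𝒜.Cochains L, (∀ w, g w ∈ I.carrier) →
      Tr.cochainTrace I k L (g ^ (k + 1)) = 0 := fun g hg => funext fun w =>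
    Tr.quotientTrace_eq_zero I k (pow_apply_mem (signAction_mem I) hg (k + 1) w)
  rw [integral_onCoeffs _ (fun a ha => Tr.cochainTrace_cochainDiff I k hodd ha)
    (chernSimons_polynomial_mem k hS), hDs, hz _ (curvature_apply_mem I hS hd hb), hz, sub_zero,
    smul_zero] at h
  · rw [chernSimons, map_smul, h, smul_zero]
  · intro w
    cases w with
    | nil => exact I.R_mem
    | cons x w => exact zero_mem _

/-- Evaluation on the empty word is a ring homomorphism that kills `s` and `D s`, so the curvature
becomes the constant polynomial `R`. -/
theorem coeff_curvature_pow_nil (S : V →ₗ[K] A) (i : ℕ) :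
    ((curvature (cochainDiff L 𝒜) (const 𝒜.R) (connection L 𝒜 S) ^ k).coeff i) [] =
      if i = 0 then 𝒜.R ^ k else 0 := by
  let e : 𝒜.Cochains L →+* A :=
    { toFun := fun g => g []
      map_one' := rfl
      map_mul' := fun _ _ => rfl
      map_zero' := rfl
      map_add' := fun _ _ => rfl }
  have e1 : e (const 𝒜.R) = 𝒜.R := rfl
  have e2 : e (connection L 𝒜 S) = 0 := rfl
  have e3 : e (cochainDiff L 𝒜 (connection L 𝒜 S)) = 0 := by
    change 𝒜.d 0 - (0 + 0) = 0
    simp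
  change e _ = _
  rw [← coeff_map, Polynomial.map_pow, curvature]
  simp only [Polynomial.map_add, Polynomial.map_mul, map_C, e1, e3, map_mul, e2, map_zero,
    mul_zero, zero_mul, add_zero]
  rw [← C_pow, coeff_C]

/-- The range of summation comes from the degree of a polynomial over cochains, hence is the same
for all words. -/
theorem chernSimons_apply (S : V →ₗ[K] A) : ∃ n, ∀ w : List L.Letter, Tr.chernSimons I k S w =
    (Nat.factorial k : K)⁻¹ • ∑ i ∈ Finset.range (n + 1), ((i + 1 : ℕ) : K)⁻¹ •
      Tr.quotientTrace I k ((connection L 𝒜 S * (curvature (cochainDiff L 𝒜) (const 𝒜.R)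
        (connection L 𝒜 S) ^ k).coeff i : 𝒜.Cochains L) w) := by
  refine ⟨(Polynomial.C (connection L 𝒜 S) *
    curvature (cochainDiff L 𝒜) (const 𝒜.R) (connection L 𝒜 S) ^ k).natDegree, fun w => ?_⟩
  rw [chernSimons, integral_eq_sum_range _ _ _ (Nat.lt_succ_self _), Pi.smul_apply,
    Finset.sum_apply]
  simp only [coeff_C_mul]
  rfl

theorem chernSimons_nil : (Tr.chernSimons I k S : List L.Letter → _) [] = 0 := by
  obtain ⟨n, h⟩ := Tr.chernSimons_apply I k (L := L) S
  rw [h, Finset.sum_eq_zero, smul_zero]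
  intro i _
  rw [mul_nil]
  change _ • Tr.quotientTrace I k (0 * _) = 0
  rw [zero_mul, map_zero, smul_zero]

/-- The factor `s` must absorb the only letter, so the power of the curvature is evaluated on the
empty word; only the coefficient of `t^0` remains, and its weight in the integral is `1`. -/
theorem chernSimons_singleton (x : L.Letter) :
    Tr.chernSimons I k S [x] =
      (Nat.factorial k : K)⁻¹ • Tr.quotientTrace I k (S x.2 * 𝒜.R ^ k) := by
  obtain ⟨n, h⟩ := Tr.chernSimons_apply I k (L := L) S
  have hx : ∀ g : 𝒜.Cochains L,
      (connection L 𝒜 S * g) [x] = S x.2 * 𝒜.signAction (par x) (g []) := fun g => by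
    rw [mul_cons, mul_nil, mul_nil, tw_apply, wordParity_nil, koszul_one_right, one_smul]
    change S x.2 * _ + 0 * _ = _
    rw [zero_mul, add_zero]
  rw [h, Finset.sum_eq_single 0]
  · rw [hx, coeff_curvature_pow_nil, if_pos rfl, map_pow, signAction_of_even _ 𝒜.R_mem]
    simp
  · intro i _ hi
    rw [hx, coeff_curvature_pow_nil, if_neg hi]
    simp
  · simp

end TraceMap

/-! ### Construction of `η^k` and computation of its linear component. -/

theorem corollary2p9 {K A C : Type*} [Field K] [CharZero K] [Ring A] [Algebra K A]
    [AddCommGroup C] [Module K C] (𝒜 : CurvedDGAlgebra K A) (I : CurvedLieIdeal 𝒜)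
    (𝒞 : DGSpace K C) (Tr : TraceMap 𝒜 𝒞) (k : ℕ) :
    ∃ η : LInfinityMorphism I.quotient ((Tr.quotient I k).shift (2 * k)).abelian,
      ∀ x : A, η.coeff 1 (fun _ => I.carrier.mkQ x) =
        (Nat.factorial k : K)⁻¹ • (Tr.image I (k + 1)).mkQ (Tr.toLin (𝒜.R ^ k * x)) := by
  obtain ⟨S, hS, hsec⟩ := I.exists_graded_section
  have hd : ∀ x, 𝒜.d (S x) - S (I.quotient.d x) ∈ I.carrier := fun x => by
    rw [← Submodule.Quotient.mk_eq_zero, Submodule.Quotient.mk_sub, sub_eq_zero]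
    refine Eq.trans ?_ (hsec _).symm
    conv_rhs => rw [← hsec x]
    rfl
  have hb : ∀ x y, S (I.quotient.bracket x y) - 𝒜.comm (S x) (S y) ∈ I.carrier := fun x y => by
    rw [← Submodule.Quotient.mk_eq_zero, Submodule.Quotient.mk_sub, sub_eq_zero]
    refine (hsec _).trans ?_
    conv_lhs => rw [← hsec x, ← hsec y]
    rfl
  -- A form of degree `1 + 2k` in the quotient complex is a form of degree one in its shift by `2k`;
  -- the shift is even, so the differential keeps its sign.
  have hf : DGLieAlgebra.IsForm (L := I.quotient) ((Tr.quotient I k).shift (2 * k)).gr 1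
      (Tr.chernSimons I k S) := by
    have h := Tr.chernSimons_isForm I k hS
    refine ⟨fun w => ?_, h.symm, h.linear⟩
    have h1 := h.degree w
    change _ ∈ (Tr.quotient I k).gr (1 + DGLieAlgebra.wordDegree w + 2 * k)
    convert h1 using 2
    ring
  have heq : ∀ w, -((Tr.quotient I k).shift (2 * k)).d (Tr.chernSimons I k S w) =
      coder DGLieAlgebra.par DGLieAlgebra.letterQ₁ (-1) w (Tr.chernSimons I k S) +
        coderBr DGLieAlgebra.par DGLieAlgebra.letterQ₂ w (Tr.chernSimons I k S) := fun w => by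
    have h : ((Tr.quotient I k).shift (2 * k)).d = (Tr.quotient I k).d := by
      change (2 * (k : ℤ)).negOnePow • _ = _
      rw [Int.negOnePow_two_mul, one_smul]
    rw [h]
    exact neg_eq_of_add_eq_zero_right (congrFun (Tr.oddDiff_chernSimons I k hS hd hb) w)
  let η := hf.toLInfinityMorphism (Tr.chernSimons_nil I k) heq
  -- The value on one-letter words is known for homogeneous elements only. Both sides are made
  -- additive in `x`, so that agreement in each degree is enough.
  let f : A →+ C ⧸ Tr.image I (k + 1) :=
    { toFun := fun x => η.coeff 1 fun _ => I.carrier.mkQ x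
      map_zero' := by
        rw [map_zero]
        exact (η.coeff 1).map_zero
      map_add' := fun x y => by
        have h := (η.coeff 1).map_update_add (fun _ => 0) 0 (I.carrier.mkQ x) (I.carrier.mkQ y)
        have e : ∀ z : A ⧸ I.carrier, Function.update (fun _ : Fin 1 => 0) 0 z = fun _ => z :=
          fun z => funext fun i => by rw [Subsingleton.elim i 0, Function.update_self]
        rwa [e, e, e, ← map_add] at h }
  let g : A →ₗ[K] C ⧸ Tr.image I (k + 1) := (Nat.factorial k : K)⁻¹ •
    Tr.quotientTrace I k ∘ₗ LinearMap.mulLeft K (𝒜.R ^ k)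
  have hfg : f = g.toAddMonoidHom := CurvedDGAlgebra.hom_ext (𝒜 := 𝒜) fun n x hx => by
    change η.coeff 1 (fun _ => I.carrier.mkQ x) =
      (Nat.factorial k : K)⁻¹ • Tr.quotientTrace I k (𝒜.R ^ k * x)
    have h := hf.toLInfinityMorphism_coeff (Tr.chernSimons_nil I k) heq
      (⟨n, I.carrier.mkQ x, ⟨x, hx, rfl⟩⟩ : I.quotient.Letter)
    refine h.trans ?_
    rw [Tr.chernSimons_singleton I k]
    congr 1
    have hI : S (I.carrier.mkQ x) - x ∈ I.carrier := by
      rw [← Submodule.Quotient.mk_eq_zero, Submodule.Quotient.mk_sub, sub_eq_zero]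
      exact hsec _
    -- One factor of `I` comes from `S(x) - x` and `k` from `R^k`: exactly the power `k + 1` that
    -- the quotient kills.
    have h1 : Tr.quotientTrace I k ((S (I.carrier.mkQ x) - x) * 𝒜.R ^ k) = 0 := by
      refine Tr.quotientTrace_eq_zero I k ?_
      rw [pow_succ']
      exact Submodule.mul_mem_mul hI (Submodule.pow_mem_pow _ I.R_mem k)
    rw [sub_mul, map_sub, sub_eq_zero] at h1
    refine h1.trans (congrArg (Tr.image I (k + 1)).mkQ ?_)
    rw [Tr.map_mul_comm hx (SetLike.pow_mem_graded k 𝒜.R_mem),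
      Int.negOnePow_even _ (by simp [parity_simps]), one_smul]
  exact ⟨η, fun x => DFunLike.congr_fun hfg x⟩
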